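/- Let $G$ be an abelian group. A $G$-grading of a unital real algebra $R$ is a decomposition $R=\bigoplus_{g\in G}R_g$ into real subspaces with $R_gR_h\subseteq R_{gh}$ for all $g,h\in G$; it is a division grading if every nonzero element of every $R_g$ is invertible in $R$. Gradings of $R$ by $G$ and of $R'$ by $G'$ are weakly isomorphic if there are an isomorphism of real algebras $\varphi:R\to R'$ and a group isomorphism $\alpha:G\to G'$ with $\varphi(R_g)=R'_{\alpha(g)}$ for all $g\in G$. The tensor product over $\mathbb{R}$ of a $G$-graded algebra $R$ and an $H$-graded algebra $S$ is $R\otimes S$ graded by $G\times H$ with $(R\otimes S)_{(g,h)}=R_g\otimes S_h$; the $0$-th tensor power is $\mathbb{R}$ with the grading by the trivial group. Put $$A=\begin{pmatrix}1&0\\0&-1\end{pmatrix},\quad B=\begin{pmatrix}0&1\\1&0\end{pmatrix},\quad C=AB=\begin{pmatrix}0&1\\-1&0\end{pmatrix},\quad \omega=\tfrac{1}{\sqrt2}(1+i),$$ and write $\langle x\rangle=\mathbb{R}x$. Consider the following graded real algebras: * $\mathbb{C}^{(2)}$: the algebra $\mathbb{C}$ graded by $\mathbb{Z}_2$ with components $\langle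 1\rangle,\langle i\rangle$ in degrees $0,1$; * $M_2^{(4)}$: the algebra $M_2(\mathbb{R})$ graded by $\mathbb{Z}_2\times\mathbb{Z}_2$ with components $\langle I\rangle,\langle A\rangle,\langle B\rangle,\langle C\rangle$ in degrees $(0,0),(1,0),(0,1),(1,1)$; * $M_2^{(8)}$: the real algebra $M_2(\mathbb{C})$ graded by $\mathbb{Z}_4\times\mathbb{Z}_2$ with components $\langle I\rangle,\langle\omega A\rangle,\langle iI\rangle,\langle i\omega A\rangle$ in degrees $(0,0),(1,0),(2,0),(3,0)$ and $\langle C\rangle,\langle\omega B\rangle,\langle iC\rangle,\langle i\omega B\rangle$ in degrees $(0,1),(1,1),(2,1),(3,1)$. **Proposition.** Let $R=M_n(\mathbb{C})$, viewed as a real algebra, be given a division grading by an abelian group $G$ such that $\dim_{\mathbb{R}}R_g=1$ for every $g\in G$. Then $n=2^k$ for some integer $k\ge 0$, and one of the following holds: 1. the grading is weakly isomorphic to $(M_2^{(4)})^{\otimes k}\otimes\mathbb{C}^{(2)}$, and $G\cong\mathbb{Z}_2^{2k+1}$ is an elementary abelian $2$-group; 2. $k\ge 1$, the grading is weakly isomorphic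 to $M_2^{(8)}\otimes(M_2^{(4)})^{\otimes(k-1)}$, and $G\cong\mathbb{Z}_4\times\mathbb{Z}_2^{2k-1}$. Both forms occur: for every $k\ge 0$ in the first case, and for every $k\ge1$ in the second, the real algebra $M_{2^k}(\mathbb{C})$ has a division grading with one-dimensional components which is weakly isomorphic to the graded algebra named there. -/

import Mathlib

open scoped TensorProduct

noncomputable section

namespace RealDivGrading

/-- A grading is a *division grading* if every nonzero homogeneous element is invertible. -/
def IsDivisionGrading {G R : Type*} [Semiring R] [Algebra ℝ R] (𝒜 : G → Submodule ℝ R) : Prop :=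
  ∀ g : G, ∀ x ∈ 𝒜 g, x ≠ 0 → IsUnit x

/-- Weak isomorphism of gradings: an isomorphism of real algebras which carries components
to components along an isomorphism of the grading groups. -/
def WeaklyIsomorphic {G H R S : Type*} [AddGroup G] [AddGroup H]
    [Semiring R] [Algebra ℝ R] [Semiring S] [Algebra ℝ S]
    (𝒜 : G → Submodule ℝ R) (ℬ : H → Submodule ℝ S) : Prop :=
  ∃ (φ : R ≃ₐ[ℝ] S) (α : G ≃+ H), ∀ g : G, (𝒜 g).map φ.toLinearMap = ℬ (α g)

/-- The tensor product of a `G`-grading and an `H`-grading, a `G × H`-grading whose component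
of degree `(g, h)` is (the image of) `R_g ⊗ S_h`. -/
def tensorGrading {G H R S : Type*} [Semiring R] [Algebra ℝ R] [Semiring S] [Algebra ℝ S]
    (𝒜 : G → Submodule ℝ R) (ℬ : H → Submodule ℝ S) : G × H → Submodule ℝ (R ⊗[ℝ] S) :=
  fun p => Submodule.map₂ (TensorProduct.mk ℝ R S) (𝒜 p.1) (ℬ p.2)

/-- The `k`-th tensor power of a `G`-grading, a `G ^ k`-grading of `R ⊗ ⋯ ⊗ R` whose component
of degree `(g₁, …, g_k)` is spanned by the `x₁ ⊗ ⋯ ⊗ x_k` with `x_i` in `R_{g_i}`.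
For `k = 0` it is the field `ℝ`, graded by the trivial group. -/
def tensorPowerGrading {G R : Type*} [Semiring R] [Algebra ℝ R]
    (𝒜 : G → Submodule ℝ R) (k : ℕ) : (Fin k → G) → Submodule ℝ (⨂[ℝ] _ : Fin k, R) :=
  fun g => Submodule.span ℝ
    {t | ∃ x : Fin k → R, (∀ i, x i ∈ 𝒜 (g i)) ∧ t = PiTensorProduct.tprod ℝ x}

/-- `A = diag(1, -1)`. -/
def matA (K : Type*) [Ring K] : Matrix (Fin 2) (Fin 2) K := !![1, 0; 0, -1]

/-- The matrix `B`, the permutation matrix of the transposition. -/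
def matB (K : Type*) [Ring K] : Matrix (Fin 2) (Fin 2) K := !![0, 1; 1, 0]

/-- The matrix `C = A B`, with `C ^ 2 = -1`. -/
def matC (K : Type*) [Ring K] : Matrix (Fin 2) (Fin 2) K := !![0, 1; -1, 0]

/-- `ω = (1 + i) / √2`, the primitive 8th root of unity with `ω ^ 2 = i`. -/
def omega : ℂ := (1 + Complex.I) / (Real.sqrt 2 : ℂ)

/-- `ℂ^{(2)}`: the field `ℂ` graded by `ℤ₂`, with components `⟨1⟩` and `⟨i⟩`. -/
def gradC2 : ZMod 2 → Submodule ℝ ℂ :=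
  fun g => Submodule.span ℝ {Complex.I ^ g.val}

/-- `M₂^{(4)}`: the algebra `M₂(ℝ)` graded by `ℤ₂ × ℤ₂`, with components
`⟨1⟩`, `⟨A⟩`, `⟨B⟩`, `⟨A B⟩ = ⟨C⟩` in degrees `(0,0)`, `(1,0)`, `(0,1)`, `(1,1)`. -/
def gradM24 : ZMod 2 × ZMod 2 → Submodule ℝ (Matrix (Fin 2) (Fin 2) ℝ) :=
  fun g => Submodule.span ℝ {matA ℝ ^ g.1.val * matB ℝ ^ g.2.val}

/-- `M₂^{(8)}`: the real algebra `M₂(ℂ)` graded by `ℤ₄ × ℤ₂`, with `ω A` in degree `(1,0)` and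
`C` in degree `(0,1)`; the components of degrees `(0,0), …, (3,0)` are
`⟨1⟩, ⟨ω A⟩, ⟨i⟩, ⟨i ω A⟩` and those of degrees `(0,1), …, (3,1)` are
`⟨C⟩, ⟨ω B⟩, ⟨i C⟩, ⟨i ω B⟩`. -/
def gradM28 : ZMod 4 × ZMod 2 → Submodule ℝ (Matrix (Fin 2) (Fin 2) ℂ) :=
  fun g => Submodule.span ℝ {(omega • matA ℂ) ^ g.1.val * matC ℂ ^ g.2.val}

/-- The real algebra `M₂(ℝ)^{⊗ k} ⊗ ℂ`. -/
abbrev AlgOne (k : ℕ) : Type :=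
  (⨂[ℝ] _ : Fin k, Matrix (Fin 2) (Fin 2) ℝ) ⊗[ℝ] ℂ

/-- The real algebra `M₂(ℂ) ⊗ M₂(ℝ)^{⊗ m}`, tensor products over `ℝ`. -/
abbrev AlgTwo (m : ℕ) : Type :=
  Matrix (Fin 2) (Fin 2) ℂ ⊗[ℝ] (⨂[ℝ] _ : Fin m, Matrix (Fin 2) (Fin 2) ℝ)

/-- The graded algebra `(M₂^{(4)})^{⊗ k} ⊗ ℂ^{(2)}`. -/
def typeOne (k : ℕ) : (Fin k → ZMod 2 × ZMod 2) × ZMod 2 → Submodule ℝ (AlgOne k) :=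
  tensorGrading (tensorPowerGrading gradM24 k) gradC2

/-- The graded algebra `M₂^{(8)} ⊗ (M₂^{(4)})^{⊗ m}`. -/
def typeTwo (m : ℕ) :
    (ZMod 4 × ZMod 2) × (Fin m → ZMod 2 × ZMod 2) → Submodule ℝ (AlgTwo m) :=
  tensorGrading gradM28 (tensorPowerGrading gradM24 m)

end RealDivGrading

end

/-!
A nonzero homogeneous element commutes with another one up to a sign, because taking the norm of
`x y = r y x` gives `r ^ dim R = 1`. These signs form an alternating bilinear form `β` on `G` with
values in `ℤ₂`. Its radical is `{0, f}`, where `f` is the degree of `i`, and multiplication by `i`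
allows one to normalize `x ^ 2` to `1`, to `-1` or to `i` according to the degree of `x ^ 2`.
If `2 G = 0`, a maximal orthogonal family of hyperbolic pairs of degrees of involutions gives `k`
commuting copies of `M₂(ℝ)`, and the centre provides the factor `ℂ`. Otherwise `2 G = {0, f}`, the
character `g ↦ 2 g` is `β c` for some `c`, and any `u` with `2 u = f` forms a hyperbolic pair with
`c`: an `x` of degree `u` with `x ^ 2 = i` and a `y` of degree `c` with `y ^ 2 = -1` generate
`M₂(ℂ)`, and the degrees orthogonal to `c` all have order at most `2`, so that the previous argument
applies to them. Conversely, both graded algebras have bases multiplying up to signs like the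
elements of a group, so that their homogeneous elements are invertible.
-/

noncomputable section

namespace RealDivGrading

section TwistedFamilies

/-- The relations between the basis elements of a twisted group algebra with twist `c`: a product
of two members of `y` is the member indexed by the sum, scaled by a unit. -/
structure IsTwistedFamily {K H S : Type*} [CommRing K] [AddMonoid H] [Ring S] [Algebra K S]
    (c : H → H → Kˣ) (y : H → S) : Prop where
  zero : y 0 = 1
  mul : ∀ g h, y g * y h = c g h • y (g + h)

variable {K G H R S : Type*} [CommRing K] [Ring R] [Algebra K R] [Ring S] [Algebra K S]

theorem map_mul_of_basis {ι : Type*} (b : Module.Basis ι K S) (f : S →ₗ[K] R)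
    (h : ∀ i j, f (b i * b j) = f (b i) * f (b j)) (s t : S) : f (s * t) = f s * f t :=
  (LinearMap.map_mul_iff f).2 (b.ext fun i => b.ext fun j => h i j) s t

namespace IsTwistedFamily

section AddMonoid

variable [AddMonoid G] [AddMonoid H] {c : H → H → Kˣ} {y : H → S}

theorem map (hy : IsTwistedFamily c y) (φ : S →ₐ[K] R) : IsTwistedFamily c fun h => φ (y h) where
  zero := by rw [hy.zero, map_one]
  mul g h := by rw [← map_mul, hy.mul, Units.smul_def, map_smul, Units.smul_def]

theorem tensor {d : G → G → Kˣ} {x : G → R} (hx : IsTwistedFamily d x)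
    (hy : IsTwistedFamily c y) :
    IsTwistedFamily (fun p q : G × H => d p.1 q.1 * c p.2 q.2) fun p => x p.1 ⊗ₜ[K] y p.2 where
  zero := by
    simp only [Prod.fst_zero, Prod.snd_zero, hx.zero, hy.zero, Algebra.TensorProduct.one_def]
  mul p q := by
    rw [Algebra.TensorProduct.tmul_mul_tmul, hx.mul, hy.mul, Units.smul_def, Units.smul_def,
      TensorProduct.smul_tmul_smul, ← Units.val_mul, Units.smul_def]
    rfl

theorem piTensor {ι : Type*} [Fintype ι] (hy : IsTwistedFamily c y) :
    IsTwistedFamily (fun g h : ι → H => ∏ i, c (g i) (h i))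
      fun g => PiTensorProduct.tprod K fun i => y (g i) where
  zero := by
    simp only [Pi.zero_apply, hy.zero]
    rfl
  mul g h := by
    rw [PiTensorProduct.tprod_mul_tprod, Units.smul_def, Units.coe_prod,
      ← MultilinearMap.map_smul_univ]
    exact congrArg _ (funext fun i => hy.mul (g i) (h i))

/-- The universal property of a twisted group algebra: a linear map which carries a twisted basis
to a family with the same twist is a homomorphism. -/
def lift {b : Module.Basis H K S} (hb : IsTwistedFamily c b) {x : H → R}
    (hx : IsTwistedFamily c x) : S →ₐ[K] R :=
  AlgHom.ofLinearMap (b.constr K x) (by rw [← hb.zero, b.constr_basis, hx.zero]) <|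
    map_mul_of_basis b _ fun g h => by
      simp only [hb.mul, b.constr_basis, hx.mul, Units.smul_def, map_smul]

theorem lift_basis {b : Module.Basis H K S} (hb : IsTwistedFamily c b) {x : H → R}
    (hx : IsTwistedFamily c x) (h : H) : hb.lift hx (b h) = x h :=
  b.constr_basis K x h

end AddMonoid

variable [AddGroup H] {c : H → H → Kˣ} {y : H → S}

theorem isUnit (hy : IsTwistedFamily c y) (h : H) : IsUnit (y h) := by
  have left : IsUnit (y h * y (-h)) := by
    rw [hy.mul, add_neg_cancel, hy.zero]
    exact isUnit_one.smul _
  have right : IsUnit (y (-h) * y h) := by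
    rw [hy.mul, neg_add_cancel, hy.zero]
    exact isUnit_one.smul _
  exact isUnit_iff_exists_and_exists.2
    ⟨⟨_, by rw [← mul_assoc, left.mul_val_inv]⟩, ⟨_, by rw [mul_assoc, right.val_inv_mul]⟩⟩

theorem linearIndependent [IsDomain K] (hy : IsTwistedFamily c y) (τ : S →ₗ[K] K)
    (h_one : τ 1 ≠ 0) (h_zero : ∀ h ≠ 0, τ (y h) = 0) : LinearIndependent K y := by
  refine linearIndependent_iff'.2 fun s a ha g hg => ?_
  have key : τ ((∑ h ∈ s, a h • y h) * y (-g)) = a g * c g (-g) * τ 1 := by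
    rw [Finset.sum_mul, map_sum, Finset.sum_eq_single_of_mem g hg fun h _ hne => ?_]
    · rw [smul_mul_assoc, hy.mul, add_neg_cancel, hy.zero, Units.smul_def, map_smul, map_smul,
        smul_smul, smul_eq_mul]
    · rw [smul_mul_assoc, hy.mul, Units.smul_def, map_smul, map_smul,
        h_zero _ (by rwa [← sub_eq_add_neg, sub_ne_zero]), smul_zero, smul_zero]
  rw [ha, zero_mul, map_zero] at key
  simpa [h_one] using key.symm

end IsTwistedFamily

theorem pow_mul_pow_of_mul_eq_neg_mul {x y : R} (h : x * y = -(y * x)) (a b : ℕ) :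
    y ^ b * x ^ a = (-1) ^ (b * a) * (x ^ a * y ^ b) := by
  have conj : SemiconjBy (y ^ b) x ((-1) ^ b * x) := by
    induction b with
    | zero => simp
    | succ b ih =>
      have hyx : SemiconjBy y ((-1) ^ b * x) ((-1) ^ b * -x) :=
        .mul_right ((Commute.neg_one_right y).pow_right b) (by rw [SemiconjBy, neg_mul, h, neg_neg])
      rw [pow_succ' y, pow_succ (-1 : R), mul_assoc, neg_one_mul]
      exact hyx.mul_left ih
  rw [(conj.pow_right a).eq, ((Commute.neg_one_left x).pow_left b).mul_pow, ← pow_mul, mul_assoc]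

/-- The twist of the powers of an element `x` with `x ^ N = r`. -/
def powTwist {N : ℕ} (r : Kˣ) (g h : ZMod N) : Kˣ :=
  r ^ ((g.val + h.val) / N)

/-- The twist of the monomials in two anticommuting elements `x`, `y` with `x ^ N = r` and
`y ^ M = s`. -/
def monomialTwist {N M : ℕ} (r s : Kˣ) (g h : ZMod N × ZMod M) : Kˣ :=
  (-1) ^ (g.2.val * h.1.val) * powTwist r g.1 h.1 * powTwist s g.2 h.2

theorem isTwistedFamily_pow {N : ℕ} [NeZero N] {x : R} {r : Kˣ} (hx : x ^ N = r • 1) :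
    IsTwistedFamily (powTwist r) fun g : ZMod N => x ^ g.val where
  zero := by simp only [ZMod.val_zero, pow_zero]
  mul g h := by
    rw [← pow_add, ZMod.val_add]
    conv_lhs => rw [← Nat.mod_add_div (g.val + h.val) N, pow_add, pow_mul, hx, smul_pow, one_pow]
    rw [mul_smul_comm, mul_one, powTwist]

theorem isTwistedFamily_monomial {N M : ℕ} [NeZero N] [NeZero M] {x y : R} {r s : Kˣ}
    (hx : x ^ N = r • 1) (hy : y ^ M = s • 1) (hxy : x * y = -(y * x)) :
    IsTwistedFamily (monomialTwist r s)
      fun g : ZMod N × ZMod M => x ^ g.1.val * y ^ g.2.val where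
  zero := by simp only [Prod.fst_zero, Prod.snd_zero, ZMod.val_zero, pow_zero, mul_one]
  mul g h := by
    have hε : ((-1) ^ (g.2.val * h.1.val) : R) = ((-1) ^ (g.2.val * h.1.val) : Kˣ) • 1 := by
      rw [Units.smul_def, ← Algebra.algebraMap_eq_smul_one]
      simp
    calc x ^ g.1.val * y ^ g.2.val * (x ^ h.1.val * y ^ h.2.val)
        = x ^ g.1.val * (y ^ g.2.val * x ^ h.1.val) * y ^ h.2.val := by simp only [mul_assoc]
      _ = ((-1) ^ (g.2.val * h.1.val) : Kˣ) •
            ((x ^ g.1.val * x ^ h.1.val) * (y ^ g.2.val * y ^ h.2.val)) := by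
          rw [pow_mul_pow_of_mul_eq_neg_mul hxy, hε]
          simp only [mul_assoc, smul_mul_assoc, mul_smul_comm, one_mul]
      _ = monomialTwist r s g h • (x ^ (g + h).1.val * y ^ (g + h).2.val) := by
          rw [(isTwistedFamily_pow hx).mul, (isTwistedFamily_pow hy).mul, smul_mul_smul_comm,
            smul_smul, ← mul_assoc]
          rfl

end TwistedFamilies

section LineGradings

variable {H R S : Type*} [Ring R] [Algebra ℝ R] [Ring S] [Algebra ℝ S]

theorem isInternal_span_singleton [DecidableEq H] (b : Module.Basis H ℝ S) :
    DirectSum.IsInternal fun h => Submodule.span ℝ {b h} :=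
  DirectSum.isInternal_submodule_of_iSupIndep_of_iSup_eq_top
    b.linearIndependent.iSupIndep_span_singleton (by rw [← Submodule.span_range_eq_iSup, b.span_eq])

/-- The grading by the lines spanned by the members of a twisted basis. -/
abbrev IsTwistedFamily.gradedAlgebra [AddMonoid H] [DecidableEq H] {c : H → H → ℝˣ}
    {b : Module.Basis H ℝ S} (hb : IsTwistedFamily c b) :
    GradedAlgebra fun h => Submodule.span ℝ {b h} :=
  { (isInternal_span_singleton b).chooseDecomposition with
    one_mem := hb.zero ▸ Submodule.mem_span_singleton_self _
    mul_mem := fun g h x y hx hy => by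
      obtain ⟨r, rfl⟩ := Submodule.mem_span_singleton.1 hx
      obtain ⟨s, rfl⟩ := Submodule.mem_span_singleton.1 hy
      rw [smul_mul_smul_comm, hb.mul]
      exact Submodule.smul_mem _ _ (Submodule.smul_mem _ _ (Submodule.mem_span_singleton_self _)) }

theorem isDivisionGrading_span_singleton {y : H → S} (hy : ∀ h, IsUnit (y h)) :
    IsDivisionGrading fun h => Submodule.span ℝ {y h} := by
  intro h x hx hx0
  obtain ⟨r, rfl⟩ := Submodule.mem_span_singleton.1 hx
  exact (hy h).smul (Units.mk0 r (left_ne_zero_of_smul hx0))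

theorem weaklyIsomorphic_span_singleton [AddGroup H] (y : H → S) (e : S ≃ₐ[ℝ] R) :
    WeaklyIsomorphic (fun h => Submodule.span ℝ {e (y h)}) fun h => Submodule.span ℝ {y h} := by
  refine ⟨e.symm, .refl H, fun h => ?_⟩
  rw [Submodule.map_span, Set.image_singleton]
  simp

theorem IsTwistedFamily.exists_isDivisionGrading [AddGroup H] [DecidableEq H] {c : H → H → ℝˣ}
    {b : Module.Basis H ℝ S} (hb : IsTwistedFamily c b) (e : S ≃ₐ[ℝ] R) :
    ∃ (𝒜 : H → Submodule ℝ R) (_ : GradedAlgebra 𝒜), IsDivisionGrading 𝒜 ∧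
      (∀ h, Module.finrank ℝ (𝒜 h) = 1) ∧
        WeaklyIsomorphic 𝒜 fun h => Submodule.span ℝ {b h} := by
  have hb' : IsTwistedFamily c (b.map e.toLinearEquiv) := hb.map e.toAlgHom
  exact ⟨_, hb'.gradedAlgebra, isDivisionGrading_span_singleton hb'.isUnit,
    fun h => finrank_span_singleton ((b.map e.toLinearEquiv).ne_zero h),
    weaklyIsomorphic_span_singleton b e⟩

theorem tensorGrading_span {G : Type*} (x : G → R) (y : H → S) :
    tensorGrading (fun g => Submodule.span ℝ {x g}) (fun h => Submodule.span ℝ {y h}) =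
      fun p => Submodule.span ℝ {x p.1 ⊗ₜ[ℝ] y p.2} := by
  funext p
  simp only [tensorGrading, Submodule.map₂_span_span, Set.image2_singleton, TensorProduct.mk_apply]

theorem tensorPowerGrading_span (x : H → R) (k : ℕ) :
    tensorPowerGrading (fun h => Submodule.span ℝ {x h}) k =
      fun g => Submodule.span ℝ {PiTensorProduct.tprod ℝ fun i => x (g i)} := by
  funext g
  refine le_antisymm (Submodule.span_le.2 ?_) ((Submodule.span_singleton_le_iff_mem _ _).2 ?_)
  · rintro _ ⟨z, hz, rfl⟩
    choose c hc using fun i => Submodule.mem_span_singleton.1 (hz i)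
    obtain rfl : (fun i => c i • x (g i)) = z := funext hc
    rw [MultilinearMap.map_smul_univ]
    exact Submodule.smul_mem _ _ (Submodule.mem_span_singleton_self _)
  · exact Submodule.subset_span ⟨_, fun i => Submodule.mem_span_singleton_self _, rfl⟩

end LineGradings

section StandardBases

section Pauli

variable (K : Type*) [CommRing K]

theorem matA_sq : matA K ^ 2 = 1 := by
  simp [pow_two, matA, Matrix.one_fin_two]

theorem matB_sq : matB K ^ 2 = 1 := by
  simp [pow_two, matB, Matrix.one_fin_two]

theorem matC_sq : matC K ^ 2 = -1 := by
  simp [pow_two, matC, Matrix.one_fin_two]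

theorem matA_mul_matB : matA K * matB K = -(matB K * matA K) := by
  simp [matA, matB]

theorem matA_mul_matC : matA K * matC K = -(matC K * matA K) := by
  simp [matA, matC]

end Pauli

theorem omega_sq : omega ^ 2 = Complex.I := by
  have h : (Real.sqrt 2 : ℂ) ^ 2 = 2 := by
    rw [← Complex.ofReal_pow, Real.sq_sqrt zero_le_two, Complex.ofReal_ofNat]
  rw [omega, div_pow, h]
  linear_combination (1 / 2 : ℂ) * Complex.I_sq

theorem omega_smul_matA_sq : (omega • matA ℂ) ^ 2 = Complex.I • 1 := by
  rw [smul_pow, matA_sq, omega_sq]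

theorem isTwistedFamily_C2 :
    IsTwistedFamily (K := ℝ) (powTwist (-1)) fun g : ZMod 2 => Complex.I ^ g.val :=
  isTwistedFamily_pow (by simp)

theorem isTwistedFamily_M24 : IsTwistedFamily (K := ℝ) (monomialTwist 1 1)
    fun g : ZMod 2 × ZMod 2 => matA ℝ ^ g.1.val * matB ℝ ^ g.2.val :=
  isTwistedFamily_monomial (by rw [matA_sq, one_smul]) (by rw [matB_sq, one_smul])
    (matA_mul_matB ℝ)

theorem isTwistedFamily_M28 : IsTwistedFamily (K := ℝ) (monomialTwist (-1) (-1))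
    fun g : ZMod 4 × ZMod 2 => (omega • matA ℂ) ^ g.1.val * matC ℂ ^ g.2.val := by
  refine isTwistedFamily_monomial ?_ (by rw [matC_sq, Units.neg_smul, one_smul]) ?_
  · rw [pow_mul _ 2 2, omega_smul_matA_sq, smul_pow, Complex.I_sq]
    simp
  · rw [smul_mul_assoc, matA_mul_matC, smul_neg, mul_smul_comm]

theorem linearIndependent_C2 : LinearIndependent ℝ fun g : ZMod 2 => Complex.I ^ g.val := by
  refine isTwistedFamily_C2.linearIndependent Complex.reLm (by simp) fun g hg => ?_
  fin_cases g
  · exact absurd rfl hg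
  · simp [ZMod.val]

theorem linearIndependent_M24 :
    LinearIndependent ℝ fun g : ZMod 2 × ZMod 2 => matA ℝ ^ g.1.val * matB ℝ ^ g.2.val := by
  refine isTwistedFamily_M24.linearIndependent (Matrix.traceLinearMap (Fin 2) ℝ ℝ) (by simp) ?_
  rintro ⟨a, b⟩ h
  fin_cases a <;> fin_cases b
  · exact absurd rfl h
  all_goals simp [ZMod.val, matA, matB, Matrix.trace_fin_two]

theorem linearIndependent_M28 : LinearIndependent ℝ
    fun g : ZMod 4 × ZMod 2 => (omega • matA ℂ) ^ g.1.val * matC ℂ ^ g.2.val := by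
  refine isTwistedFamily_M28.linearIndependent
    (Complex.reLm ∘ₗ Matrix.traceLinearMap (Fin 2) ℝ ℂ) (by simp) ?_
  have re_omega_sq : omega.re * omega.re - omega.im * omega.im = 0 := by
    rw [← Complex.mul_re, ← pow_two, omega_sq, Complex.I_re]
  rintro ⟨a, b⟩ h
  fin_cases a <;> fin_cases b
  · exact absurd rfl h
  all_goals simp [ZMod.val, pow_succ, matA, matC, Matrix.trace_fin_two, re_omega_sq]

/-- The homogeneous basis of `ℂ^{(2)}`. -/
def basisC2 : Module.Basis (ZMod 2) ℝ ℂ :=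
  basisOfLinearIndependentOfCardEqFinrank linearIndependent_C2 (by simp)

/-- The homogeneous basis of `M₂^{(4)}`. -/
def basisM24 : Module.Basis (ZMod 2 × ZMod 2) ℝ (Matrix (Fin 2) (Fin 2) ℝ) :=
  basisOfLinearIndependentOfCardEqFinrank linearIndependent_M24 (by simp [Module.finrank_matrix])

/-- The homogeneous basis of `M₂^{(8)}`. -/
def basisM28 : Module.Basis (ZMod 4 × ZMod 2) ℝ (Matrix (Fin 2) (Fin 2) ℂ) :=
  basisOfLinearIndependentOfCardEqFinrank linearIndependent_M28 (by simp [Module.finrank_matrix])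

theorem coe_basisC2 : ⇑basisC2 = fun g => Complex.I ^ g.val :=
  coe_basisOfLinearIndependentOfCardEqFinrank ..

theorem coe_basisM24 : ⇑basisM24 = fun g => matA ℝ ^ g.1.val * matB ℝ ^ g.2.val :=
  coe_basisOfLinearIndependentOfCardEqFinrank ..

theorem coe_basisM28 : ⇑basisM28 = fun g => (omega • matA ℂ) ^ g.1.val * matC ℂ ^ g.2.val :=
  coe_basisOfLinearIndependentOfCardEqFinrank ..

theorem isTwistedFamily_basisC2 : IsTwistedFamily (K := ℝ) (powTwist (-1)) basisC2 :=
  coe_basisC2 ▸ isTwistedFamily_C2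

theorem isTwistedFamily_basisM24 : IsTwistedFamily (K := ℝ) (monomialTwist 1 1) basisM24 :=
  coe_basisM24 ▸ isTwistedFamily_M24

theorem isTwistedFamily_basisM28 : IsTwistedFamily (K := ℝ) (monomialTwist (-1) (-1)) basisM28 :=
  coe_basisM28 ▸ isTwistedFamily_M28

/-- The homogeneous basis of `(M₂^{(4)})^{⊗ k}`. -/
def basisPower (k : ℕ) : Module.Basis (Fin k → ZMod 2 × ZMod 2) ℝ
    (⨂[ℝ] _ : Fin k, Matrix (Fin 2) (Fin 2) ℝ) :=
  Basis.piTensorProduct fun _ => basisM24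

/-- The homogeneous basis of `(M₂^{(4)})^{⊗ k} ⊗ ℂ^{(2)}`. -/
def basisOne (k : ℕ) : Module.Basis ((Fin k → ZMod 2 × ZMod 2) × ZMod 2) ℝ (AlgOne k) :=
  (basisPower k).tensorProduct basisC2

/-- The homogeneous basis of `M₂^{(8)} ⊗ (M₂^{(4)})^{⊗ m}`. -/
def basisTwo (m : ℕ) :
    Module.Basis ((ZMod 4 × ZMod 2) × (Fin m → ZMod 2 × ZMod 2)) ℝ (AlgTwo m) :=
  basisM28.tensorProduct (basisPower m)

theorem coe_basisPower (k : ℕ) :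
    ⇑(basisPower k) = fun g => PiTensorProduct.tprod ℝ fun i => basisM24 (g i) :=
  funext fun _ => Basis.piTensorProduct_apply ..

theorem coe_basisOne (k : ℕ) : ⇑(basisOne k) = fun p => basisPower k p.1 ⊗ₜ basisC2 p.2 :=
  funext fun _ => Module.Basis.tensorProduct_apply' ..

theorem coe_basisTwo (m : ℕ) : ⇑(basisTwo m) = fun p => basisM28 p.1 ⊗ₜ basisPower m p.2 :=
  funext fun _ => Module.Basis.tensorProduct_apply' ..

theorem exists_isTwistedFamily_basisPower (k : ℕ) :
    ∃ c : _ → _ → ℝˣ, IsTwistedFamily c (basisPower k) :=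
  ⟨_, coe_basisPower k ▸ isTwistedFamily_basisM24.piTensor⟩

theorem exists_isTwistedFamily_basisOne (k : ℕ) :
    ∃ c : _ → _ → ℝˣ, IsTwistedFamily c (basisOne k) :=
  have ⟨_, hpower⟩ := exists_isTwistedFamily_basisPower k
  ⟨_, coe_basisOne k ▸ hpower.tensor isTwistedFamily_basisC2⟩

theorem exists_isTwistedFamily_basisTwo (m : ℕ) :
    ∃ c : _ → _ → ℝˣ, IsTwistedFamily c (basisTwo m) :=
  have ⟨_, hpower⟩ := exists_isTwistedFamily_basisPower m
  ⟨_, coe_basisTwo m ▸ isTwistedFamily_basisM28.tensor hpower⟩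

theorem tensorPowerGrading_gradM24 (k : ℕ) :
    tensorPowerGrading gradM24 k = fun g => Submodule.span ℝ {basisPower k g} := by
  rw [coe_basisPower, coe_basisM24]
  exact tensorPowerGrading_span _ k

theorem typeOne_eq_span (k : ℕ) : typeOne k = fun h => Submodule.span ℝ {basisOne k h} := by
  rw [typeOne, tensorPowerGrading_gradM24, coe_basisOne, coe_basisC2]
  exact tensorGrading_span ..

theorem typeTwo_eq_span (m : ℕ) : typeTwo m = fun h => Submodule.span ℝ {basisTwo m h} := by
  rw [typeTwo, tensorPowerGrading_gradM24, coe_basisTwo, coe_basisM28]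
  exact tensorGrading_span ..

end StandardBases

section MatrixModels

section MatrixUnits

variable (ι n K : Type*) [Fintype ι] [Fintype n] [DecidableEq n] [CommRing K]

/-- The basis of a tensor power of a matrix algebra formed by the tensor products of matrix
units, indexed by the multi-indices of their rows and columns. -/
def tensorMatrixUnits :
    Module.Basis ((ι → n) × (ι → n)) K (⨂[K] _ : ι, Matrix n n K) :=
  (Basis.piTensorProduct fun _ => Matrix.stdBasis K n n).reindex
    (Equiv.arrowProdEquivProdArrow ι (fun _ => n) fun _ => n)

variable {ι n K}

theorem tensorMatrixUnits_apply (p q : ι → n) :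
    tensorMatrixUnits ι n K (p, q) =
      PiTensorProduct.tprod K fun i => Matrix.single (p i) (q i) 1 := by
  rw [tensorMatrixUnits, Module.Basis.reindex_apply, Basis.piTensorProduct_apply]
  exact congrArg _ (funext fun i => Matrix.stdBasis_eq_single K (p i) (q i))

theorem tensorMatrixUnits_mul (p q p' q' : ι → n) :
    tensorMatrixUnits ι n K (p, q) * tensorMatrixUnits ι n K (p', q') =
      if q = p' then tensorMatrixUnits ι n K (p, q') else 0 := by
  simp only [tensorMatrixUnits_apply, PiTensorProduct.tprod_mul_tprod]
  split_ifs with h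
  · exact congrArg _ (funext fun i => by simp [h])
  · obtain ⟨i, hi⟩ := Function.ne_iff.1 h
    exact MultilinearMap.map_coord_zero _ i (by simp [hi])

variable [DecidableEq ι]

variable (ι n K) in
/-- The linear identification of a tensor power of a matrix algebra with a matrix algebra, which
matches the tensor products of matrix units with the matrix units. -/
def piTensorMatrixLinearEquiv :
    (⨂[K] _ : ι, Matrix n n K) ≃ₗ[K] Matrix (ι → n) (ι → n) K :=
  (tensorMatrixUnits ι n K).equiv (Matrix.stdBasis K (ι → n) (ι → n)) (Equiv.refl _)

theorem piTensorMatrixLinearEquiv_tensorMatrixUnits (p q : ι → n) :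
    piTensorMatrixLinearEquiv ι n K (tensorMatrixUnits ι n K (p, q)) = Matrix.single p q 1 :=
  ((tensorMatrixUnits ι n K).equiv_apply ..).trans (Matrix.stdBasis_eq_single K p q)

theorem piTensorMatrixLinearEquiv_mul (s t : ⨂[K] _ : ι, Matrix n n K) :
    piTensorMatrixLinearEquiv ι n K (s * t) =
      piTensorMatrixLinearEquiv ι n K s * piTensorMatrixLinearEquiv ι n K t := by
  refine map_mul_of_basis (tensorMatrixUnits ι n K) (piTensorMatrixLinearEquiv ι n K).toLinearMap
    ?_ s t
  rintro ⟨p, q⟩ ⟨p', q'⟩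
  rw [LinearEquiv.coe_coe, tensorMatrixUnits_mul, piTensorMatrixLinearEquiv_tensorMatrixUnits,
    piTensorMatrixLinearEquiv_tensorMatrixUnits]
  split_ifs with h
  · rw [piTensorMatrixLinearEquiv_tensorMatrixUnits, h, Matrix.single_mul_single_same, one_mul]
  · rw [map_zero, Matrix.single_mul_single_of_ne _ _ _ _ h]

variable (ι n K) in
/-- A tensor power of a matrix algebra is a matrix algebra. -/
def piTensorMatrixAlgEquiv : (⨂[K] _ : ι, Matrix n n K) ≃ₐ[K] Matrix (ι → n) (ι → n) K :=
  .ofLinearEquiv (piTensorMatrixLinearEquiv ι n K)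
    (map_one (MulEquiv.mk (piTensorMatrixLinearEquiv ι n K).toEquiv piTensorMatrixLinearEquiv_mul))
    piTensorMatrixLinearEquiv_mul

end MatrixUnits

/-- The model `M_{2^k}(ℂ)` of `M₂(ℝ)^{⊗ k} ⊗ ℂ`. -/
def algOneEquivMatrix (k : ℕ) : AlgOne k ≃ₐ[ℝ] Matrix (Fin (2 ^ k)) (Fin (2 ^ k)) ℂ :=
  have card_eq : Fintype.card (Fin k → Fin 2) = Fintype.card (Fin (2 ^ k)) := by simp
  (Algebra.TensorProduct.congr (piTensorMatrixAlgEquiv (Fin k) (Fin 2) ℝ) .refl).trans <|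
    (Algebra.TensorProduct.comm ℝ _ ℂ).trans <|
      (matrixEquivTensor (Fin k → Fin 2) ℝ ℂ).symm.trans <|
        Matrix.reindexAlgEquiv ℝ ℂ (Fintype.equivOfCardEq card_eq)

/-- The model `M_{2^{m+1}}(ℂ)` of `M₂(ℂ) ⊗ M₂(ℝ)^{⊗ m}`. -/
def algTwoEquivMatrix (m : ℕ) :
    AlgTwo m ≃ₐ[ℝ] Matrix (Fin (2 ^ (m + 1))) (Fin (2 ^ (m + 1))) ℂ :=
  have card_eq : Fintype.card ((Fin m → Fin 2) × Fin 2) = Fintype.card (Fin (2 ^ (m + 1))) := by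
    simp [pow_succ]
  (Algebra.TensorProduct.congr .refl (piTensorMatrixAlgEquiv (Fin m) (Fin 2) ℝ)).trans <|
    (matrixEquivTensor (Fin m → Fin 2) ℝ (Matrix (Fin 2) (Fin 2) ℂ)).symm.trans <|
      (Matrix.compAlgEquiv (Fin m → Fin 2) (Fin 2) ℂ ℝ).trans <|
        Matrix.reindexAlgEquiv ℝ ℂ (Fintype.equivOfCardEq card_eq)

instance isSimpleRing_algOne (k : ℕ) : IsSimpleRing (AlgOne k) :=
  .of_ringEquiv (algOneEquivMatrix k).symm.toRingEquiv inferInstance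

instance isSimpleRing_algTwo (m : ℕ) : IsSimpleRing (AlgTwo m) :=
  .of_ringEquiv (algTwoEquivMatrix m).symm.toRingEquiv inferInstance

end MatrixModels

section Homomorphisms

theorem commute_of_basis {K H R S : Type*} [CommRing K] [Ring R] [Algebra K R] [AddCommGroup S]
    [Module K S] (b : Module.Basis H K S) (f : S →ₗ[K] R) {z : R}
    (hz : ∀ h, Commute z (f (b h))) (s : S) : Commute z (f s) :=
  LinearMap.congr_fun (b.ext fun h => hz h : LinearMap.mulLeft K z ∘ₗ f =
    LinearMap.mulRight K z ∘ₗ f) s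

section PiTensorLift

variable {ι K M R : Type*} [Fintype ι] [CommRing K] [Ring M] [Algebra K M] [Ring R] [Algebra K R]
  (ψ : ι → M →ₐ[K] R) (hψ : Pairwise fun i j => ∀ x y, Commute (ψ i x) (ψ j y))

/-- The homomorphism from a tensor power induced by pairwise commuting homomorphisms. -/
def piTensorLift : (⨂[K] _ : ι, M) →ₐ[K] R :=
  letI := Classical.decEq ι
  let F := MonoidHom.noncommPiCoprod (fun i => (ψ i : M →* R)) hψ
  have F_update (x : ι → M) (i : ι) (m : M) :
      F (Function.update x i m) = F (Function.update x i 1) * ψ i m := by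
    rw [← mul_one x, ← one_mul m, Function.update_mul, map_mul, one_mul, mul_one]
    exact congrArg _ (MonoidHom.noncommPiCoprod_mulSingle ..)
  PiTensorProduct.liftAlgHom
    { toFun := F
      map_update_add' := fun {d} x i m m' => by
        rw [Subsingleton.elim d (Classical.decEq ι), F_update, map_add, mul_add, ← F_update,
          ← F_update]
      map_update_smul' := fun {d} x i c m => by
        rw [Subsingleton.elim d (Classical.decEq ι), F_update, map_smul, mul_smul_comm,
          ← F_update] }
    (map_one F) (map_mul F)

theorem piTensorLift_tprod (x : ι → M) :
    piTensorLift ψ hψ (PiTensorProduct.tprod K x) =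
      Finset.univ.noncommProd (fun i => ψ i (x i)) fun _ _ _ _ h => hψ h _ _ := by
  rw [piTensorLift, PiTensorProduct.liftAlgHom_apply, PiTensorProduct.lift.tprod]
  rfl

end PiTensorLift

theorem noncommProd_mem_graded {ι G A σ : Type*} [AddCommMonoid G] [Monoid A] [SetLike σ A]
    (𝒜 : G → σ) [SetLike.GradedMonoid 𝒜] {s : Finset ι} {f : ι → A} {d : ι → G}
    (hc : (s : Set ι).Pairwise (Function.onFun Commute f)) (h : ∀ i ∈ s, f i ∈ 𝒜 (d i)) :
    s.noncommProd f hc ∈ 𝒜 (∑ i ∈ s, d i) := by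
  classical
  induction s using Finset.induction_on with
  | empty => simpa using SetLike.GradedOne.one_mem
  | insert i s hi ih =>
    rw [Finset.noncommProd_insert_of_notMem _ _ _ _ hi, Finset.sum_insert hi]
    exact SetLike.GradedMul.mul_mem (h i (Finset.mem_insert_self i s))
      (ih _ fun j hj => h j (Finset.mem_insert_of_mem hj))

end Homomorphisms

section WeakIsomorphism

variable {G R : Type*} [Ring R] [Algebra ℝ R] {𝒜 : G → Submodule ℝ R}

theorem exists_smul_of_mem (h1 : ∀ g, Module.finrank ℝ (𝒜 g) = 1) {g : G} {x y : R}
    (hx : x ∈ 𝒜 g) (hx0 : x ≠ 0) (hy : y ∈ 𝒜 g) : ∃ r : ℝ, r • x = y :=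
  Submodule.mem_span_singleton.1 <|
    eq_span_singleton_of_mem_of_finrank_eq_one (h1 g) hx hx0 ▸ hy

theorem exists_smul_one_of_mem [AddMonoid G] [SetLike.GradedMonoid 𝒜] [Nontrivial R]
    (h1 : ∀ g, Module.finrank ℝ (𝒜 g) = 1) {x : R} (hx : x ∈ 𝒜 0) : ∃ r : ℝ, r • 1 = x :=
  exists_smul_of_mem h1 SetLike.GradedOne.one_mem one_ne_zero hx

theorem weaklyIsomorphic_of_algHom [AddGroup G] [DecidableEq G] [GradedAlgebra 𝒜] [Nontrivial R]
    {H S : Type*} [AddGroup H] [Ring S] [IsSimpleRing S] [Algebra ℝ S] (b : Module.Basis H ℝ S)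
    (hb : b 0 = 1) (h1 : ∀ g, Module.finrank ℝ (𝒜 g) = 1) (φ : S →ₐ[ℝ] R) {α : H →+ G}
    (hα : Function.Surjective α) (hφ : ∀ h, φ (b h) ∈ 𝒜 (α h)) :
    WeaklyIsomorphic 𝒜 fun h => Submodule.span ℝ {b h} := by
  have φ_inj : Function.Injective φ := RingHom.injective φ.toRingHom
  have α_inj : Function.Injective α := by
    refine (injective_iff_map_eq_zero α).2 fun h hh => by_contra fun h0 => ?_
    obtain ⟨r, hr⟩ := exists_smul_one_of_mem h1 (hh ▸ hφ h)
    have hbh : r • b 0 = b h := φ_inj (by rw [map_smul, hb, map_one, hr])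
    have := congrArg (fun s => b.repr s h) hbh
    simp [Finsupp.single_eq_of_ne h0] at this
  have comp_eq (h : H) : 𝒜 (α h) = Submodule.span ℝ {φ (b h)} :=
    eq_span_singleton_of_mem_of_finrank_eq_one (h1 _) (hφ h)
      ((map_ne_zero_iff φ φ_inj).2 (b.ne_zero h))
  have φ_surj : Function.Surjective φ := by
    suffices LinearMap.range φ.toLinearMap = ⊤ from LinearMap.range_eq_top.1 this
    rw [eq_top_iff, ← (DirectSum.Decomposition.isInternal 𝒜).submodule_iSup_eq_top]
    refine iSup_le fun g => ?_
    obtain ⟨h, rfl⟩ := hα g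
    rw [comp_eq, Submodule.span_singleton_le_iff_mem]
    exact ⟨b h, rfl⟩
  let e : S ≃ₐ[ℝ] R := .ofBijective φ ⟨φ_inj, φ_surj⟩
  let a : H ≃+ G := .ofBijective α ⟨α_inj, hα⟩
  refine ⟨e.symm, a.symm, fun g => ?_⟩
  obtain ⟨h, rfl⟩ := hα g
  have he : e.symm (φ (b h)) = b h := e.symm_apply_apply (b h)
  have ha : a.symm (α h) = h := a.symm_apply_apply h
  rw [comp_eq, Submodule.map_span, Set.image_singleton, AlgEquiv.toLinearMap_apply, he, ha]

end WeakIsomorphism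

section OneDimensionalComponents

variable {G R : Type*} [Ring R] [Algebra ℝ R] {𝒜 : G → Submodule ℝ R}

theorem exists_mem_ne_zero (h1 : ∀ g, Module.finrank ℝ (𝒜 g) = 1) (g : G) :
    ∃ x ∈ 𝒜 g, x ≠ 0 :=
  Submodule.exists_mem_ne_zero_of_ne_bot fun h =>
    zero_ne_one (α := ℕ) (by rw [← h1 g, h, finrank_bot])

theorem nontrivial_of_finrank [Nonempty G] (h1 : ∀ g, Module.finrank ℝ (𝒜 g) = 1) :
    Nontrivial R :=
  have ⟨x, _, hx0⟩ := exists_mem_ne_zero h1 (Classical.arbitrary G)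
  nontrivial_of_ne x 0 hx0

theorem finite_of_finrank [AddMonoid G] [DecidableEq G] [GradedAlgebra 𝒜]
    [FiniteDimensional ℝ R] (h1 : ∀ g, Module.finrank ℝ (𝒜 g) = 1) : Finite G := by
  choose x hx hx0 using exists_mem_ne_zero h1
  have hli : LinearIndependent ℝ x :=
    (DirectSum.Decomposition.isInternal 𝒜).submodule_iSupIndep.linearIndependent 𝒜 hx hx0
  exact hli.finite

end OneDimensionalComponents

section CommutationForm

theorem neg_one_pow_val_injective :
    Function.Injective fun a : ZMod 2 => (-1 : ℝ) ^ a.val := by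
  intro a b h
  fin_cases a <;> fin_cases b <;> first | rfl | norm_num [ZMod.val] at h

theorem neg_one_pow_val_add (a b : ZMod 2) :
    (-1 : ℝ) ^ (a + b).val = (-1) ^ a.val * (-1) ^ b.val := by
  rw [ZMod.val_add, ← neg_one_pow_eq_pow_mod_two, pow_add]

theorem eq_neg_one_pow_of_mul_eq_smul_mul {R : Type*} [Ring R] [Nontrivial R] [Algebra ℝ R]
    [FiniteDimensional ℝ R] {x y : R} (hx : IsUnit x) (hy : IsUnit y) {r : ℝ}
    (h : x * y = r • (y * x)) : ∃ a : ZMod 2, r = (-1) ^ a.val := by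
  have norm_ne_zero : Algebra.norm ℝ (x * y) ≠ 0 := ((hx.mul hy).map _).ne_zero
  have norm_eq := congrArg (Algebra.norm ℝ) h
  rw [Algebra.smul_def, map_mul _ (algebraMap ℝ R r), Algebra.norm_algebraMap, map_mul _ y,
    mul_comm (Algebra.norm ℝ y), ← map_mul] at norm_eq
  have r_pow : r ^ Module.finrank ℝ R = 1 := (right_eq_mul₀ norm_ne_zero).1 norm_eq
  rcases (pow_eq_one_iff_cases).1 r_pow with hR | rfl | ⟨rfl, -⟩
  · exact absurd hR Module.finrank_pos.ne'
  · exact ⟨0, by simp⟩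
  · exact ⟨1, by simp [ZMod.val_one]⟩

/-- `β` is the commutation form of the grading `𝒜`: homogeneous elements of degrees `g` and `h`
commute up to the sign `(-1) ^ β g h`. -/
def IsCommutationForm {G R : Type*} [AddCommGroup G] [Ring R] [Algebra ℝ R]
    (𝒜 : G → Submodule ℝ R) (β : G →+ G →+ ZMod 2) : Prop :=
  ∀ ⦃g h x y⦄, x ∈ 𝒜 g → y ∈ 𝒜 h → x * y = (-1 : ℝ) ^ (β g h).val • (y * x)

theorem sign_unique {R : Type*} [AddCommGroup R] [Module ℝ R] {z : R} (hz : z ≠ 0) {a b : ZMod 2}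
    (h : (-1 : ℝ) ^ a.val • z = (-1 : ℝ) ^ b.val • z) : a = b :=
  neg_one_pow_val_injective (smul_left_injective ℝ hz h)

variable {G R : Type*} [AddCommGroup G] [Ring R] [Algebra ℝ R] {𝒜 : G → Submodule ℝ R}

theorem exists_commutation_sign [SetLike.GradedMonoid 𝒜] [FiniteDimensional ℝ R]
    (hdiv : IsDivisionGrading 𝒜) (h1 : ∀ g, Module.finrank ℝ (𝒜 g) = 1) (g h : G) :
    ∃ a : ZMod 2, ∀ x ∈ 𝒜 g, ∀ y ∈ 𝒜 h, x * y = (-1 : ℝ) ^ a.val • (y * x) := by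
  have := nontrivial_of_finrank h1
  obtain ⟨x, hx, hx0⟩ := exists_mem_ne_zero h1 g
  obtain ⟨y, hy, hy0⟩ := exists_mem_ne_zero h1 h
  have x_unit := hdiv g x hx hx0
  have y_unit := hdiv h y hy hy0
  obtain ⟨r, hr⟩ := exists_smul_of_mem h1 (add_comm h g ▸ SetLike.GradedMul.mul_mem hy hx)
    (y_unit.mul x_unit).ne_zero (SetLike.GradedMul.mul_mem hx hy)
  obtain ⟨a, rfl⟩ := eq_neg_one_pow_of_mul_eq_smul_mul x_unit y_unit hr.symm
  refine ⟨a, fun x' hx' y' hy' => ?_⟩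
  obtain ⟨s, rfl⟩ := exists_smul_of_mem h1 hx hx0 hx'
  obtain ⟨t, rfl⟩ := exists_smul_of_mem h1 hy hy0 hy'
  rw [smul_mul_smul_comm, smul_mul_smul_comm, ← hr, smul_comm, mul_comm s t]

theorem exists_isCommutationForm [SetLike.GradedMonoid 𝒜] [FiniteDimensional ℝ R]
    (hdiv : IsDivisionGrading 𝒜) (h1 : ∀ g, Module.finrank ℝ (𝒜 g) = 1) :
    ∃ β, IsCommutationForm 𝒜 β := by
  have := nontrivial_of_finrank h1
  choose B hB using exists_commutation_sign hdiv h1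
  choose x hx hx0 using exists_mem_ne_zero h1
  have x_unit (g : G) : IsUnit (x g) := hdiv g _ (hx g) (hx0 g)
  have B_symm (g h : G) : B g h = B h g := by
    refine sign_unique ((x_unit h).mul (x_unit g)).ne_zero ?_
    rw [← hB g h _ (hx g) _ (hx h), hB h g _ (hx h) _ (hx g), smul_smul, ← mul_pow, neg_one_mul,
      neg_neg, one_pow, one_smul]
  have B_add (g g' h : G) : B (g + g') h = B g h + B g' h := by
    refine sign_unique ((x_unit h).mul ((x_unit g).mul (x_unit g'))).ne_zero ?_
    rw [← hB (g + g') h _ (SetLike.GradedMul.mul_mem (hx g) (hx g')) _ (hx h), mul_assoc,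
      hB g' h _ (hx g') _ (hx h), mul_smul_comm, ← mul_assoc, hB g h _ (hx g) _ (hx h),
      smul_mul_assoc, smul_smul, neg_one_pow_val_add, mul_comm, mul_assoc]
  let β : G →+ G →+ ZMod 2 := AddMonoidHom.mk' (fun g => AddMonoidHom.mk' (B g) fun h h' => by
    rw [B_symm, B_add, B_symm h, B_symm h']) fun g g' => AddMonoidHom.ext (B_add g g')
  exact ⟨β, fun g h x y hx hy => hB g h x hx y hy⟩

namespace IsCommutationForm

variable {β : G →+ G →+ ZMod 2} {g h : G} {x y : R}

theorem commute (hβ : IsCommutationForm 𝒜 β) (hx : x ∈ 𝒜 g) (hy : y ∈ 𝒜 h)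
    (hgh : β g h = 0) : Commute x y :=
  show x * y = y * x by simpa [hgh] using hβ hx hy

theorem anticommute (hβ : IsCommutationForm 𝒜 β) (hx : x ∈ 𝒜 g) (hy : y ∈ 𝒜 h)
    (hgh : β g h = 1) : x * y = -(y * x) := by
  simpa [hgh, ZMod.val_one] using hβ hx hy

theorem eq_zero_of_commute (hβ : IsCommutationForm 𝒜 β) (hx : x ∈ 𝒜 g) (hy : y ∈ 𝒜 h)
    (hxy : y * x ≠ 0) (hc : Commute x y) : β g h = 0 :=
  sign_unique hxy <| by rw [← hβ hx hy, hc.eq, ZMod.val_zero, pow_zero, one_smul]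

theorem self_eq_zero (hβ : IsCommutationForm 𝒜 β) (hdiv : IsDivisionGrading 𝒜)
    (h1 : ∀ g, Module.finrank ℝ (𝒜 g) = 1) (g : G) : β g g = 0 := by
  have := nontrivial_of_finrank h1
  obtain ⟨x, hx, hx0⟩ := exists_mem_ne_zero h1 g
  have x_unit := hdiv g x hx hx0
  exact hβ.eq_zero_of_commute hx hx (x_unit.mul x_unit).ne_zero (.refl x)

theorem eq_zero_of_central (hβ : IsCommutationForm 𝒜 β) (hdiv : IsDivisionGrading 𝒜)
    (h1 : ∀ g, Module.finrank ℝ (𝒜 g) = 1) (hx : x ∈ 𝒜 g) (hx0 : x ≠ 0)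
    (hc : ∀ y, Commute x y) : β g = 0 := by
  ext h
  obtain ⟨y, hy, hy0⟩ := exists_mem_ne_zero h1 h
  exact hβ.eq_zero_of_commute hx hy ((hdiv h y hy hy0).mul_right_eq_zero.not.2 hx0) (hc y)

theorem commute_of_eq_zero [DecidableEq G] [GradedAlgebra 𝒜] (hβ : IsCommutationForm 𝒜 β)
    (hg : β g = 0) (hx : x ∈ 𝒜 g) (y : R) : Commute x y := by
  induction y using DirectSum.Decomposition.inductionOn 𝒜 with
  | zero => exact .zero_right x
  | homogeneous y => exact hβ.commute hx y.2 (by rw [hg, AddMonoidHom.zero_apply])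
  | add y y' hy hy' => exact hy.add_right hy'

end IsCommutationForm

end CommutationForm

section DegreeOfI

variable {G R : Type*} [AddCommGroup G] [Ring R] [Algebra ℝ R] {𝒜 : G → Submodule ℝ R}
  [DecidableEq G] [GradedAlgebra 𝒜]

theorem commute_decompose_of_central {z : R} (hz : ∀ x, Commute z x) (g : G) (x : R) :
    Commute (DirectSum.decompose 𝒜 z g : R) x := by
  induction x using DirectSum.Decomposition.inductionOn 𝒜 with
  | zero => exact .zero_right _
  | @homogeneous h x =>
    rw [commute_iff_eq, ← DirectSum.coe_decompose_mul_add_of_right_mem 𝒜 x.2, (hz x).eq, add_comm,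
      DirectSum.coe_decompose_mul_add_of_left_mem 𝒜 x.2]
  | add x x' hx hx' => exact hx.add_right hx'

theorem exists_decompose_ne_zero {x : R} (hx : x ∉ 𝒜 0) :
    ∃ f ≠ 0, (DirectSum.decompose 𝒜 x f : R) ≠ 0 := by
  classical
  by_contra! h
  refine hx ?_
  rw [← DirectSum.sum_support_decompose 𝒜 x]
  refine sum_mem fun f _ => ?_
  obtain rfl | hf := eq_or_ne f 0
  · exact (DirectSum.decompose 𝒜 x 0).2
  · exact h f hf ▸ zero_mem _

theorem eq_zero_of_eq_add {f g h : G} {x y z : R} (hx : x ∈ 𝒜 f) (hy : y ∈ 𝒜 g) (hz : z ∈ 𝒜 h)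
    (hg : g ≠ f) (hh : h ≠ f) (hxyz : x = y + z) : x = 0 := by
  rw [← DirectSum.decompose_of_mem_same 𝒜 hx, hxyz, DirectSum.decompose_add, DirectSum.add_apply,
    Submodule.coe_add, DirectSum.decompose_of_mem_ne 𝒜 hy hg,
    DirectSum.decompose_of_mem_ne 𝒜 hz hh, add_zero]

variable {i : ℂ →ₐ[ℝ] R}

theorem algHom_eq_re_add_im (w : ℂ) :
    i w = algebraMap ℝ R w.re + w.im • i Complex.I := by
  rw [← map_smul, ← i.commutes, ← map_add]
  exact congrArg i (by simp)

theorem algHom_I_mul_I (i : ℂ →ₐ[ℝ] R) : i Complex.I * i Complex.I = -1 := by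
  rw [← map_mul, Complex.I_mul_I, map_neg, map_one]

theorem commute_of_range_eq_center (hi : i.range = Subalgebra.center ℝ R) (w : ℂ) (x : R) :
    Commute (i w) x :=
  (Subalgebra.mem_center_iff.1 (hi ▸ i.mem_range_self w) x).symm

theorem exists_eq_of_central (hi : i.range = Subalgebra.center ℝ R) {z : R}
    (hz : ∀ x, Commute z x) : ∃ w, i w = z :=
  i.mem_range.1 <| hi ▸ Subalgebra.mem_center_iff.2 fun x => (hz x).symm.eq

variable [Nontrivial R]

theorem algHom_I_notMem_zero (h1 : ∀ g, Module.finrank ℝ (𝒜 g) = 1) : i Complex.I ∉ 𝒜 0 := by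
  intro hI
  obtain ⟨r, hr⟩ := exists_smul_one_of_mem h1 hI
  rw [← Algebra.algebraMap_eq_smul_one, ← i.commutes] at hr
  simpa using congrArg Complex.im (i.toRingHom.injective hr)

theorem add_self_eq_zero_of_algHom_I_mem {f : G} (hI : i Complex.I ∈ 𝒜 f) : f + f = 0 :=
  DirectSum.degree_eq_of_mem_mem 𝒜 (algHom_I_mul_I i ▸ SetLike.GradedMul.mul_mem hI hI)
    (neg_mem SetLike.GradedOne.one_mem) (neg_ne_zero.2 one_ne_zero)

theorem algHom_I_mem_of_mem {f : G} (hf : f ≠ 0) {w : ℂ} (hw : i w ∈ 𝒜 f) (hw0 : w ≠ 0) :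
    i Complex.I ∈ 𝒜 f := by
  have w_quadratic : (2 * w.re) • w = w * w + algebraMap ℝ ℂ (Complex.normSq w) := by
    rw [Complex.coe_algebraMap, Complex.normSq_eq_conj_mul_self, ← add_mul, Complex.add_conj]
    rfl
  have re_smul : (2 * w.re) • i w = 0 := by
    refine eq_zero_of_eq_add (Submodule.smul_mem _ _ hw) (SetLike.GradedMul.mul_mem hw hw)
      (SetLike.algebraMap_mem_graded 𝒜 (Complex.normSq w)) (add_eq_left.not.2 hf) hf.symm ?_
    rw [← map_smul, ← map_mul, ← i.commutes, ← map_add, w_quadratic]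
  have re_eq : w.re = 0 := by
    have := (smul_eq_zero.1 re_smul).resolve_right ((map_ne_zero_iff i i.toRingHom.injective).2 hw0)
    linarith
  have im_ne : w.im ≠ 0 := fun h => hw0 (Complex.ext re_eq h)
  rw [algHom_eq_re_add_im, re_eq, map_zero, zero_add] at hw
  exact (Submodule.smul_mem_iff _ im_ne).1 hw

theorem exists_algHom_I_mem (hi : i.range = Subalgebra.center ℝ R)
    (h1 : ∀ g, Module.finrank ℝ (𝒜 g) = 1) : ∃ f, i Complex.I ∈ 𝒜 f := by
  obtain ⟨f, hf0, hf⟩ := exists_decompose_ne_zero (algHom_I_notMem_zero (i := i) h1)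
  obtain ⟨w, hw⟩ := exists_eq_of_central hi <|
    commute_decompose_of_central (𝒜 := 𝒜) (commute_of_range_eq_center hi Complex.I) f
  refine ⟨f, algHom_I_mem_of_mem (w := w) hf0 (hw ▸ SetLike.coe_mem _) ?_⟩
  rintro rfl
  exact hf (hw.symm.trans (map_zero i))

theorem IsCommutationForm.eq_zero_iff {β : G →+ G →+ ZMod 2} (hβ : IsCommutationForm 𝒜 β)
    (hi : i.range = Subalgebra.center ℝ R) (hdiv : IsDivisionGrading 𝒜)
    (h1 : ∀ g, Module.finrank ℝ (𝒜 g) = 1) {f : G} (hI : i Complex.I ∈ 𝒜 f) {g : G} :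
    β g = 0 ↔ g = 0 ∨ g = f := by
  refine ⟨fun hg => ?_, ?_⟩
  · obtain ⟨x, hx, hx0⟩ := exists_mem_ne_zero h1 g
    obtain ⟨w, rfl⟩ := exists_eq_of_central hi (hβ.commute_of_eq_zero hg hx)
    by_contra! h
    exact hx0 <| eq_zero_of_eq_add hx (SetLike.algebraMap_mem_graded 𝒜 w.re)
      (Submodule.smul_mem _ w.im hI) h.1.symm h.2.symm (algHom_eq_re_add_im w)
  · rintro (rfl | rfl)
    · exact map_zero β
    · exact hβ.eq_zero_of_central hdiv h1 hI
        ((map_ne_zero_iff i i.toRingHom.injective).2 Complex.I_ne_zero)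
        (commute_of_range_eq_center hi Complex.I)

theorem exists_mul_self_eq (hi : i.range = Subalgebra.center ℝ R) (hdiv : IsDivisionGrading 𝒜)
    (h1 : ∀ g, Module.finrank ℝ (𝒜 g) = 1) {f : G} (hI : i Complex.I ∈ 𝒜 f) {g : G} {u : R}
    (hu : u ∈ 𝒜 (g + g)) : ∃ g', (g' = g ∨ g' = g + f) ∧ ∃ x ∈ 𝒜 g', x * x = u := by
  obtain ⟨x, hx, hx0⟩ := exists_mem_ne_zero h1 g
  have x_unit := hdiv g x hx hx0
  obtain ⟨r, hr⟩ := exists_smul_of_mem h1 (SetLike.GradedMul.mul_mem hx hx)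
    (x_unit.mul x_unit).ne_zero hu
  obtain h | h := le_total 0 r
  · refine ⟨g, .inl rfl, Real.sqrt r • x, Submodule.smul_mem _ _ hx, ?_⟩
    rw [smul_mul_smul_comm, Real.mul_self_sqrt h, hr]
  · refine ⟨g + f, .inr rfl, Real.sqrt (-r) • (x * i Complex.I),
      Submodule.smul_mem _ _ (SetLike.GradedMul.mul_mem hx hI), ?_⟩
    rw [smul_mul_smul_comm, Real.mul_self_sqrt (neg_nonneg.2 h),
      (commute_of_range_eq_center hi _ _).mul_mul_mul_comm, algHom_I_mul_I, mul_neg_one, smul_neg,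
      neg_smul, neg_neg, hr]

end DegreeOfI

section Symplectic

variable {G : Type*} [AddCommGroup G]

theorem form_comm {β : G →+ G →+ ZMod 2} (hβ : ∀ g, β g g = 0) (g h : G) : β g h = β h g := by
  have := hβ (g + h)
  simp only [map_add, AddMonoidHom.add_apply, hβ, zero_add, add_zero] at this
  rw [← CharTwo.sub_eq_add, sub_eq_zero] at this
  exact this.symm

/-- `w` is orthogonal, with respect to the form `β`, to both entries of every pair in `s`. -/
def IsOrthogonal (β : G →+ G →+ ZMod 2) (w : G) (s : Finset (G × G)) : Prop :=
  ∀ p ∈ s, β w p.1 = 0 ∧ β w p.2 = 0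

/-- The pairs in `s` are hyperbolic for the form `β`, and distinct pairs are mutually
orthogonal. -/
structure IsSymplectic (β : G →+ G →+ ZMod 2) (s : Finset (G × G)) : Prop where
  pairing : ∀ p ∈ s, β p.1 p.2 = 1
  orthogonal : ∀ p ∈ s, ∀ q ∈ s, p ≠ q → IsOrthogonal β p.1 {q} ∧ IsOrthogonal β p.2 {q}

/-- The combination of the entries of a symplectic set `s` which represents the character `q`
on them. -/
def symplecticDual (s : Finset (G × G)) (q : G →+ ZMod 2) : G :=
  ∑ p ∈ s, ((q p.2).val • p.1 + (q p.1).val • p.2)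

variable {β : G →+ G →+ ZMod 2} {s : Finset (G × G)}

theorem IsSymplectic.mono {t : Finset (G × G)} (hs : IsSymplectic β s) (h : t ⊆ s) :
    IsSymplectic β t :=
  ⟨fun p hp => hs.pairing p (h hp), fun p hp q hq => hs.orthogonal p (h hp) q (h hq)⟩

theorem IsSymplectic.insert [DecidableEq G] (hβ : ∀ g, β g g = 0) (hs : IsSymplectic β s) {u v : G}
    (huv : β u v = 1) (hu : IsOrthogonal β u s) (hv : IsOrthogonal β v s) :
    IsSymplectic β (insert (u, v) s) where
  pairing := Finset.forall_mem_insert _ _ _ |>.2 ⟨huv, hs.pairing⟩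
  orthogonal p hp q hq hpq := by
    obtain rfl | hp := Finset.mem_insert.1 hp <;> obtain rfl | hq := Finset.mem_insert.1 hq
    · exact absurd rfl hpq
    · simp [IsOrthogonal, hu q hq, hv q hq]
    · simp [IsOrthogonal, form_comm hβ p.1, form_comm hβ p.2, hu p hp, hv p hp]
    · exact hs.orthogonal p hp q hq hpq

theorem IsOrthogonal.form_symplecticDual {w : G} (hw : IsOrthogonal β w s) (q : G →+ ZMod 2) :
    β w (symplecticDual s q) = 0 := by
  rw [symplecticDual, map_sum]
  refine Finset.sum_eq_zero fun p hp => ?_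
  rw [map_add, map_nsmul, map_nsmul, (hw p hp).1, (hw p hp).2, smul_zero, smul_zero, add_zero]

theorem IsSymplectic.form_symplecticDual (hβ : ∀ g, β g g = 0) (hs : IsSymplectic β s)
    (q : G →+ ZMod 2) {p : G × G} (hp : p ∈ s) :
    β (symplecticDual s q) p.1 = q p.1 ∧ β (symplecticDual s q) p.2 = q p.2 := by
  have form_eq (g : G) (hg : ∀ r ∈ s, r ≠ p → β r.1 g = 0 ∧ β r.2 g = 0) :
      β (symplecticDual s q) g = q p.2 * β p.1 g + q p.1 * β p.2 g := by
    rw [symplecticDual, map_sum, AddMonoidHom.finsetSum_apply,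
      Finset.sum_eq_single_of_mem p hp fun r hr hrp => by simp [hg r hr hrp]]
    simp
  have orthogonal (r : G × G) (hr : r ∈ s) (hrp : r ≠ p) := hs.orthogonal r hr p hp hrp
  simp only [IsOrthogonal, Finset.mem_singleton, forall_eq] at orthogonal
  constructor
  · rw [form_eq _ fun r hr hrp => ⟨(orthogonal r hr hrp).1.1, (orthogonal r hr hrp).2.1⟩, hβ,
      form_comm hβ, hs.pairing p hp, mul_zero, zero_add, mul_one]
  · rw [form_eq _ fun r hr hrp => ⟨(orthogonal r hr hrp).1.2, (orthogonal r hr hrp).2.2⟩, hβ,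
      hs.pairing p hp, mul_zero, add_zero, mul_one]

theorem IsSymplectic.isOrthogonal_sub (hβ : ∀ g, β g g = 0) (hs : IsSymplectic β s) (g : G) :
    IsOrthogonal β (g - symplecticDual s (β g)) s := by
  intro p hp
  obtain ⟨h₁, h₂⟩ := hs.form_symplecticDual hβ (β g) hp
  simp only [map_sub, AddMonoidHom.sub_apply, h₁, h₂, sub_self, and_self]

theorem IsSymplectic.eq_top (hβ : ∀ g, β g g = 0) (hs : IsSymplectic β s) {K : AddSubgroup G}
    (hsK : ∀ p ∈ s, p.1 ∈ K ∧ p.2 ∈ K) (hK : ∀ w, IsOrthogonal β w s → w ∈ K) : K = ⊤ := by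
  refine eq_top_iff.2 fun g _ => ?_
  rw [← sub_add_cancel g (symplecticDual s (β g))]
  refine K.add_mem (hK _ (hs.isOrthogonal_sub hβ g)) (sum_mem fun p hp => ?_)
  exact K.add_mem (nsmul_mem (hsK p hp).1 _) (nsmul_mem (hsK p hp).2 _)

theorem IsSymplectic.form_symplecticDual_eq (hβ : ∀ g, β g g = 0) (hs : IsSymplectic β s)
    {q : G →+ ZMod 2} (hq : ∀ w, IsOrthogonal β w s → β w = 0 ∧ q w = 0) :
    β (symplecticDual s q) = q := by
  have := hs.eq_top hβ (K := (q - β (symplecticDual s q)).ker) (fun p hp => ?_) fun w hw => ?_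
  · exact (sub_eq_zero.1 (AddMonoidHom.ker_eq_top_iff.1 this)).symm
  · obtain ⟨h₁, h₂⟩ := hs.form_symplecticDual hβ q hp
    simp [AddMonoidHom.mem_ker, h₁, h₂]
  · simp [AddMonoidHom.mem_ker, (hq w hw).2, form_comm hβ _ w, (hq w hw).1]

theorem IsSymplectic.exists_insert [DecidableEq G] (hβ : ∀ g, β g g = 0) (hs : IsSymplectic β s)
    {P : G → Prop} (hP : ∀ w, IsOrthogonal β w s → ∃ w', P w' ∧ β w' = β w) {w : G}
    (hw : IsOrthogonal β w s) (hw0 : β w ≠ 0) :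
    ∃ u v, P u ∧ P v ∧ (u, v) ∉ s ∧ IsSymplectic β (Insert.insert (u, v) s) := by
  obtain ⟨v, hv⟩ := DFunLike.ne_iff.1 hw0
  obtain ⟨w', hPw, hw'⟩ := hP w hw
  obtain ⟨v', hPv, hv'⟩ := hP _ (hs.isOrthogonal_sub hβ v)
  have hw's : IsOrthogonal β w' s := by rwa [IsOrthogonal, hw']
  have hv's : IsOrthogonal β v' s := by
    rw [IsOrthogonal, hv']
    exact hs.isOrthogonal_sub hβ v
  have form_eq : β w' v' = 1 := by
    rw [form_comm hβ, hv', form_comm hβ, hw', map_sub, hw.form_symplecticDual, sub_zero]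
    exact Fin.eq_one_of_ne_zero _ hv
  refine ⟨w', v', hPw, hPv, fun h => ?_, hs.insert hβ form_eq hw's hv's⟩
  exact zero_ne_one ((hw's _ h).2.symm.trans form_eq)

theorem IsSymplectic.exists_maximal [Finite G] (hβ : ∀ g, β g g = 0) (hs : IsSymplectic β s)
    {P : G → Prop} (hP : ∀ w, IsOrthogonal β w s → ∃ w', P w' ∧ β w' = β w) :
    ∃ t, s ⊆ t ∧ IsSymplectic β t ∧ (∀ p ∈ t, p ∉ s → P p.1 ∧ P p.2) ∧
      ∀ w, IsOrthogonal β w t → β w = 0 := by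
  classical
  obtain ⟨t, hst, ht⟩ := Set.Finite.exists_le_maximal
    (Set.toFinite {t | s ⊆ t ∧ IsSymplectic β t ∧ ∀ p ∈ t, p ∉ s → P p.1 ∧ P p.2})
    (a := s) ⟨subset_rfl, hs, fun p hp hp' => absurd hp hp'⟩
  obtain ⟨-, ht_symp, htP⟩ := ht.prop
  refine ⟨t, hst, ht_symp, htP, fun w hw => by_contra fun hw0 => ?_⟩
  obtain ⟨u, v, hu, hv, huv, huv_symp⟩ := ht_symp.exists_insert hβ
    (fun w hw => hP w fun p hp => hw p (hst hp)) hw hw0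
  refine huv (ht.le_of_ge ⟨?_, huv_symp, ?_⟩ (Finset.subset_insert _ _)
    (Finset.mem_insert_self _ _))
  · exact hst.trans (Finset.subset_insert _ _)
  · simp only [Finset.forall_mem_insert]
    exact ⟨fun _ => ⟨hu, hv⟩, htP⟩

end Symplectic

section GradedHomomorphisms

variable {G R : Type*} [AddCommGroup G] [Ring R] [Algebra ℝ R] {𝒜 : G → Submodule ℝ R}

theorem exists_zmod_hom {N : ℕ} [NeZero N] {u : G} (hu : N • u = 0) :
    ∃ α : ZMod N →+ G, ∀ a, α a = a.val • u := by
  let φ : {φ : ℤ →+ G // φ N = 0} := ⟨zmultiplesHom G u, (natCast_zsmul u N).trans hu⟩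
  refine ⟨ZMod.lift N φ, fun a => ?_⟩
  have lift_val := ZMod.lift_coe N φ a.val
  rw [Int.cast_natCast, ZMod.natCast_zmod_val] at lift_val
  exact lift_val.trans (natCast_zsmul u a.val)

theorem exists_pi_hom {ι H : Type*} [Fintype ι] [AddCommGroup H] (α : ι → H →+ G) :
    ∃ α' : (ι → H) →+ G, (∀ g, α' g = ∑ i, α i (g i)) ∧ α'.range = ⨆ i, (α i).range :=
  ⟨.noncommPiCoprod α fun _ _ _ _ _ => .all _ _, fun _ => Finset.noncommSum_eq_sum _ _,
    AddMonoidHom.noncommPiCoprod_range _⟩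

theorem nsmul_eq_zero_of_pow_eq [DecidableEq G] [GradedAlgebra 𝒜] [Nontrivial R] {N : ℕ} {u : G}
    {x : R} {r : ℝˣ} (hx : x ∈ 𝒜 u) (hxN : x ^ N = r • 1) : N • u = 0 :=
  DirectSum.degree_eq_of_mem_mem 𝒜 (hxN ▸ SetLike.pow_mem_graded N hx)
    (Submodule.smul_mem _ (r : ℝ) SetLike.GradedOne.one_mem) (isUnit_one.smul r).ne_zero

theorem exists_algHom_of_anticommute [DecidableEq G] [GradedAlgebra 𝒜] [Nontrivial R] {S : Type*}
    [Ring S] [Algebra ℝ S] {N M : ℕ} [NeZero N] [NeZero M] {r s : ℝˣ}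
    {b : Module.Basis (ZMod N × ZMod M) ℝ S} (hb : IsTwistedFamily (monomialTwist r s) b)
    {u v : G} {x y : R} (hx : x ∈ 𝒜 u) (hy : y ∈ 𝒜 v) (hxN : x ^ N = r • 1) (hyM : y ^ M = s • 1)
    (hxy : x * y = -(y * x)) :
    ∃ (ψ : S →ₐ[ℝ] R) (α : ZMod N × ZMod M →+ G), (∀ h, ψ (b h) ∈ 𝒜 (α h)) ∧
      ∀ h, α h = h.1.val • u + h.2.val • v := by
  obtain ⟨α₁, hα₁⟩ := exists_zmod_hom (nsmul_eq_zero_of_pow_eq hx hxN)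
  obtain ⟨α₂, hα₂⟩ := exists_zmod_hom (nsmul_eq_zero_of_pow_eq hy hyM)
  have α_eq (h : ZMod N × ZMod M) : α₁.coprod α₂ h = h.1.val • u + h.2.val • v := by
    rw [AddMonoidHom.coprod_apply, hα₁, hα₂]
  refine ⟨hb.lift (isTwistedFamily_monomial hxN hyM hxy), α₁.coprod α₂, fun h => ?_, α_eq⟩
  rw [hb.lift_basis, α_eq]
  exact SetLike.GradedMul.mul_mem (SetLike.pow_mem_graded _ hx) (SetLike.pow_mem_graded _ hy)

namespace IsCommutationForm

variable {β : G →+ G →+ ZMod 2} {H S H' S' : Type*} [Ring S] [Algebra ℝ S] [Ring S'] [Algebra ℝ S']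
  {b : Module.Basis H ℝ S} {b' : Module.Basis H' ℝ S'}

theorem commute_algHom (hβ : IsCommutationForm 𝒜 β) {α : H → G} {α' : H' → G} {φ : S →ₐ[ℝ] R}
    {φ' : S' →ₐ[ℝ] R} (hφ : ∀ h, φ (b h) ∈ 𝒜 (α h)) (hφ' : ∀ h, φ' (b' h) ∈ 𝒜 (α' h))
    (hα : ∀ g h, β (α g) (α' h) = 0) (s : S) (s' : S') : Commute (φ s) (φ' s') :=
  commute_of_basis b' φ'.toLinearMap (fun h' => (commute_of_basis b φ.toLinearMap
    (fun h => (hβ.commute (hφ h) (hφ' h') (hα h h')).symm) s).symm) s'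

theorem exists_algHom_tensor [SetLike.GradedMonoid 𝒜] [AddCommGroup H] [AddCommGroup H']
    (hβ : IsCommutationForm 𝒜 β) {α : H →+ G} {α' : H' →+ G} {φ : S →ₐ[ℝ] R} {φ' : S' →ₐ[ℝ] R}
    (hφ : ∀ h, φ (b h) ∈ 𝒜 (α h)) (hφ' : ∀ h, φ' (b' h) ∈ 𝒜 (α' h))
    (hα : ∀ g h, β (α g) (α' h) = 0) :
    ∃ Φ : S ⊗[ℝ] S' →ₐ[ℝ] R, ∀ p : H × H', Φ (b p.1 ⊗ₜ b' p.2) ∈ 𝒜 (α.coprod α' p) := by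
  refine ⟨Algebra.TensorProduct.lift φ φ' (hβ.commute_algHom hφ hφ' hα), fun p => ?_⟩
  rw [Algebra.TensorProduct.lift_tmul]
  exact SetLike.GradedMul.mul_mem (hφ p.1) (hφ' p.2)

theorem exists_algHom_piTensor [SetLike.GradedMonoid 𝒜] {ι : Type*} [Fintype ι]
    (hβ : IsCommutationForm 𝒜 β) {α : ι → H → G} {ψ : ι → S →ₐ[ℝ] R}
    (hψ : ∀ i h, ψ i (b h) ∈ 𝒜 (α i h))
    (hα : Pairwise fun i j => ∀ g h, β (α i g) (α j h) = 0) :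
    ∃ Ψ : (⨂[ℝ] _ : ι, S) →ₐ[ℝ] R, ∀ g : ι → H,
      Ψ (PiTensorProduct.tprod ℝ fun i => b (g i)) ∈ 𝒜 (∑ i, α i (g i)) := by
  have commute : Pairwise fun i j => ∀ x y, Commute (ψ i x) (ψ j y) := fun i j hij =>
    hβ.commute_algHom (hψ i) (hψ j) (hα hij)
  refine ⟨piTensorLift ψ commute, fun g => ?_⟩
  rw [piTensorLift_tprod]
  exact noncommProd_mem_graded 𝒜 _ fun i _ => hψ i (g i)

theorem exists_algHom_basisPower [DecidableEq G] [GradedAlgebra 𝒜] [Nontrivial R]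
    (hβ : IsCommutationForm 𝒜 β) {t : Finset (G × G)} (ht : IsSymplectic β t)
    (ht_sq : ∀ p ∈ t, (∃ x ∈ 𝒜 p.1, x * x = 1) ∧ ∃ y ∈ 𝒜 p.2, y * y = 1) :
    ∃ (k : ℕ) (Ψ : (⨂[ℝ] _ : Fin k, Matrix (Fin 2) (Fin 2) ℝ) →ₐ[ℝ] R)
      (α : (Fin k → ZMod 2 × ZMod 2) →+ G), (∀ h, Ψ (basisPower k h) ∈ 𝒜 (α h)) ∧
      (∀ p ∈ t, p.1 ∈ α.range ∧ p.2 ∈ α.range) ∧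
      ∀ w, IsOrthogonal β w t → ∀ h, β w (α h) = 0 := by
  let e := t.equivFin.symm
  have exists_factor (i : Fin t.card) : ∃ (ψ : Matrix (Fin 2) (Fin 2) ℝ →ₐ[ℝ] R)
      (α : ZMod 2 × ZMod 2 →+ G), (∀ h, ψ (basisM24 h) ∈ 𝒜 (α h)) ∧
      ∀ h, α h = h.1.val • (e i).1.1 + h.2.val • (e i).1.2 := by
    obtain ⟨⟨x, hx, hxx⟩, y, hy, hyy⟩ := ht_sq _ (e i).2
    exact exists_algHom_of_anticommute isTwistedFamily_basisM24 hx hy (by rw [sq, hxx, one_smul])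
      (by rw [sq, hyy, one_smul]) (hβ.anticommute hx hy (ht.pairing _ (e i).2))
  choose ψ α hψ hα using exists_factor
  have form_eq_zero {w : G} {i : Fin t.card} (hw : IsOrthogonal β w {(e i).1})
      (h : ZMod 2 × ZMod 2) : β w (α i h) = 0 := by
    obtain ⟨h₁, h₂⟩ := hw _ (Finset.mem_singleton_self _)
    simp only [hα, map_add, map_nsmul, h₁, h₂, smul_zero, add_zero]
  obtain ⟨Ψ, hΨ⟩ := hβ.exists_algHom_piTensor hψ fun i j hij g h => by
    obtain ⟨h₁, h₂⟩ := ht.orthogonal _ (e i).2 _ (e j).2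
      fun h => hij (e.injective (Subtype.ext h))
    simp only [hα i, map_add, map_nsmul, AddMonoidHom.add_apply, AddMonoidHom.nsmul_apply,
      form_eq_zero h₁, form_eq_zero h₂, smul_zero, add_zero]
  obtain ⟨α', hα', range_eq⟩ := exists_pi_hom α
  refine ⟨t.card, Ψ, α', fun h => ?_, fun p hp => ?_, fun w hw h => ?_⟩
  · rw [coe_basisPower, hα']
    exact hΨ h
  · obtain ⟨i, hi⟩ := e.surjective ⟨p, hp⟩
    have range_le : (α i).range ≤ α'.range := range_eq ▸ le_iSup (fun i => (α i).range) i
    exact ⟨range_le ⟨(1, 0), by simp [hα, hi, ZMod.val_one]⟩,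
      range_le ⟨(0, 1), by simp [hα, hi, ZMod.val_one]⟩⟩
  · rw [hα', map_sum]
    refine Finset.sum_eq_zero fun i _ => form_eq_zero (fun p hp => hw p ?_) _
    exact Finset.mem_singleton.1 hp ▸ (e i).2

end IsCommutationForm

end GradedHomomorphisms

section Classification

section Forms

variable {G : Type*} [AddCommGroup G] {β : G →+ G →+ ZMod 2}

theorem isSymplectic_empty : IsSymplectic β ∅ :=
  ⟨by simp, by simp⟩

theorem IsSymplectic.isOrthogonal_erase [DecidableEq G] {s : Finset (G × G)} (hs : IsSymplectic β s)
    {p : G × G} (hp : p ∈ s) :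
    IsOrthogonal β p.1 (s.erase p) ∧ IsOrthogonal β p.2 (s.erase p) := by
  have orthogonal (q : G × G) (hq : q ∈ s.erase p) :=
    hs.orthogonal p hp q (Finset.mem_of_mem_erase hq) (Finset.ne_of_mem_erase hq).symm
  exact ⟨fun q hq => (orthogonal q hq).1 q (Finset.mem_singleton_self q),
    fun q hq => (orthogonal q hq).2 q (Finset.mem_singleton_self q)⟩

theorem exists_form_eq [Finite G] (hβ : ∀ g, β g g = 0) {q : G →+ ZMod 2}
    (hq : ∀ w, β w = 0 → q w = 0) : ∃ c, β c = q := by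
  obtain ⟨t, -, ht, -, ht_max⟩ :=
    isSymplectic_empty.exists_maximal hβ (P := fun _ => True) fun w _ => ⟨w, trivial, rfl⟩
  exact ⟨symplecticDual t q, ht.form_symplecticDual_eq hβ fun w hw =>
    ⟨ht_max w hw, hq w (ht_max w hw)⟩⟩

theorem exists_hom_eq_zero_iff_add_self_eq_zero {f : G} (hff : f + f = 0)
    (hG : ∀ g : G, g + g = 0 ∨ g + g = f) :
    ∃ q : G →+ ZMod 2, ∀ g, q g = 0 ↔ g + g = 0 := by
  classical
  refine ⟨AddMonoidHom.mk' (fun g => if g + g = 0 then 0 else 1) fun g h => ?_, fun g => by simp⟩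
  rw [add_add_add_comm]
  rcases hG g with hg | hg <;> rcases hG h with hh | hh <;> by_cases hf : f = 0 <;>
    simp [hg, hh, hff, hf, CharTwo.add_self_eq_zero]

theorem range_coprod {H K : Type*} [AddCommGroup H] [AddCommGroup K] (φ : H →+ G) (ψ : K →+ G) :
    (φ.coprod ψ).range = φ.range ⊔ ψ.range := by
  ext g
  simp [AddSubgroup.mem_sup]

end Forms

variable {G R : Type*} [AddCommGroup G] [DecidableEq G] [Ring R] [Algebra ℝ R]
  {𝒜 : G → Submodule ℝ R} [GradedAlgebra 𝒜] {i : ℂ →ₐ[ℝ] R}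
  {β : G →+ G →+ ZMod 2} {f : G}

theorem add_self_eq_of_mul_self_eq_algHom_I [Nontrivial R] (hI : i Complex.I ∈ 𝒜 f) {u : G}
    (hu : ∃ x ∈ 𝒜 u, x * x = i Complex.I) : u + u = f := by
  obtain ⟨x, hx, hxx⟩ := hu
  exact DirectSum.degree_eq_of_mem_mem 𝒜 (hxx ▸ SetLike.GradedMul.mul_mem hx hx) hI
    ((map_ne_zero_iff i i.toRingHom.injective).2 Complex.I_ne_zero)

namespace IsCommutationForm

theorem exists_mul_self_eq [Nontrivial R] (hβ : IsCommutationForm 𝒜 β)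
    (hi : i.range = Subalgebra.center ℝ R) (hdiv : IsDivisionGrading 𝒜)
    (h1 : ∀ g, Module.finrank ℝ (𝒜 g) = 1) (hI : i Complex.I ∈ 𝒜 f) {g : G} {u : R}
    (hu : u ∈ 𝒜 (g + g)) : ∃ g', (∃ x ∈ 𝒜 g', x * x = u) ∧ β g' = β g := by
  obtain ⟨g', rfl | rfl, hx⟩ := RealDivGrading.exists_mul_self_eq hi hdiv h1 hI hu
  · exact ⟨g', hx, rfl⟩
  · exact ⟨g + f, hx, by rw [map_add, (hβ.eq_zero_iff hi hdiv h1 hI).2 (.inr rfl), add_zero]⟩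

theorem weaklyIsomorphic_typeOne [FiniteDimensional ℝ R] (hβ : IsCommutationForm 𝒜 β)
    (hi : i.range = Subalgebra.center ℝ R) (hdiv : IsDivisionGrading 𝒜)
    (h1 : ∀ g, Module.finrank ℝ (𝒜 g) = 1) (hI : i Complex.I ∈ 𝒜 f)
    (hG : ∀ g : G, g + g = 0) : ∃ k, WeaklyIsomorphic (S := AlgOne k) 𝒜 (typeOne k) := by
  have := nontrivial_of_finrank h1
  have := finite_of_finrank h1
  have form_self := hβ.self_eq_zero hdiv h1
  have ker_iff {g : G} := hβ.eq_zero_iff hi hdiv h1 hI (g := g)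
  obtain ⟨t, -, ht, ht_sq, ht_max⟩ := isSymplectic_empty.exists_maximal form_self
    fun w _ => hβ.exists_mul_self_eq hi hdiv h1 hI (hG w ▸ SetLike.GradedOne.one_mem)
  obtain ⟨k, Ψ, α, hΨ, t_mem, -⟩ :=
    hβ.exists_algHom_basisPower ht fun p hp => ht_sq p hp (Finset.notMem_empty p)
  obtain ⟨γ, hγ⟩ := exists_zmod_hom (N := 2) (two_nsmul f ▸ hG f)
  have i_mem (h : ZMod 2) : i (basisC2 h) ∈ 𝒜 (γ h) := by
    rw [coe_basisC2, map_pow, hγ]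
    exact SetLike.pow_mem_graded _ hI
  have form_γ (g : Fin k → ZMod 2 × ZMod 2) (h : ZMod 2) : β (α g) (γ h) = 0 := by
    rw [hγ, map_nsmul, form_comm form_self, ker_iff.2 (.inr rfl), AddMonoidHom.zero_apply,
      smul_zero]
  obtain ⟨Φ, hΦ⟩ := hβ.exists_algHom_tensor hΨ i_mem form_γ
  have surjective : Function.Surjective (α.coprod γ) := by
    rw [← AddMonoidHom.range_eq_top, range_coprod]
    refine ht.eq_top form_self (fun p hp => ?_) fun w hw => AddSubgroup.mem_sup_right ?_
    · exact (t_mem p hp).imp AddSubgroup.mem_sup_left AddSubgroup.mem_sup_left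
    · obtain rfl | rfl := ker_iff.1 (ht_max w hw)
      · exact zero_mem _
      · exact ⟨1, by simp [hγ, ZMod.val_one]⟩
  refine ⟨k, ?_⟩
  rw [typeOne_eq_span]
  obtain ⟨c, hc⟩ := exists_isTwistedFamily_basisOne k
  exact weaklyIsomorphic_of_algHom (S := AlgOne k) _ hc.zero h1 Φ surjective fun p => by
    rw [coe_basisOne]
    exact hΦ p

theorem exists_anticommute_pair [Finite G] [Nontrivial R] (hβ : IsCommutationForm 𝒜 β)
    (hi : i.range = Subalgebra.center ℝ R) (hdiv : IsDivisionGrading 𝒜)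
    (h1 : ∀ g, Module.finrank ℝ (𝒜 g) = 1) (hI : i Complex.I ∈ 𝒜 f) (hG : ∃ g : G, g + g ≠ 0) :
    ∃ u v, (∃ x ∈ 𝒜 u, x * x = i Complex.I) ∧ (∃ y ∈ 𝒜 v, y * y = -1) ∧ β u v = 1 ∧
      ∀ w, β w v = 0 → w + w = 0 := by
  have form_self := hβ.self_eq_zero hdiv h1
  have ker_iff {g : G} := hβ.eq_zero_iff hi hdiv h1 hI (g := g)
  have double (g : G) : g + g = 0 ∨ g + g = f :=
    ker_iff.1 (by rw [map_add]; ext h; exact CharTwo.add_self_eq_zero _)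
  obtain ⟨q, hq⟩ := exists_hom_eq_zero_iff_add_self_eq_zero
    (add_self_eq_zero_of_algHom_I_mem hI) double
  obtain ⟨c, rfl⟩ := exists_form_eq form_self fun w hw => (hq w).2 <| by
    obtain rfl | rfl := ker_iff.1 hw
    · exact add_zero 0
    · exact add_self_eq_zero_of_algHom_I_mem hI
  obtain ⟨g, hg⟩ := hG
  obtain ⟨u, hu, hug⟩ := hβ.exists_mul_self_eq hi hdiv h1 hI
    (((double g).resolve_left hg).symm ▸ hI)
  obtain ⟨v, hv, hvc⟩ := hβ.exists_mul_self_eq hi hdiv h1 hI (g := c) (u := -1)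
    ((hq c).1 (form_self c) ▸ neg_mem SetLike.GradedOne.one_mem)
  refine ⟨u, v, hu, hv, ?_, fun w hw => (hq w).1 (by rw [← hvc, form_comm form_self, hw])⟩
  rw [hug, form_comm form_self, hvc]
  exact Fin.eq_one_of_ne_zero _ ((hq g).not.2 hg)

theorem exists_isSymplectic_mem [Finite G] [Nontrivial R] (hβ : IsCommutationForm 𝒜 β)
    (hi : i.range = Subalgebra.center ℝ R) (hdiv : IsDivisionGrading 𝒜)
    (h1 : ∀ g, Module.finrank ℝ (𝒜 g) = 1) (hI : i Complex.I ∈ 𝒜 f) (hG : ∃ g : G, g + g ≠ 0) :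
    ∃ u v, (∃ x ∈ 𝒜 u, x * x = i Complex.I) ∧ (∃ y ∈ 𝒜 v, y * y = -1) ∧
      ∃ t, (u, v) ∈ t ∧ IsSymplectic β t ∧
        (∀ p ∈ t.erase (u, v), (∃ x ∈ 𝒜 p.1, x * x = 1) ∧ ∃ y ∈ 𝒜 p.2, y * y = 1) ∧
        ∀ w, IsOrthogonal β w t → β w = 0 := by
  have form_self := hβ.self_eq_zero hdiv h1
  obtain ⟨u, v, hu, hv, huv, two_torsion⟩ := hβ.exists_anticommute_pair hi hdiv h1 hI hG
  have uv_symp : IsSymplectic β {(u, v)} :=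
    isSymplectic_empty.insert form_self huv (by simp [IsOrthogonal]) (by simp [IsOrthogonal])
  obtain ⟨t, uv_mem, ht, ht_sq, ht_max⟩ := uv_symp.exists_maximal form_self fun w hw =>
    hβ.exists_mul_self_eq hi hdiv h1 hI (g := w) (u := 1) <|
      two_torsion w (hw _ (Finset.mem_singleton_self _)).2 ▸ SetLike.GradedOne.one_mem
  exact ⟨u, v, hu, hv, t, Finset.singleton_subset_iff.1 uv_mem, ht, fun p hp =>
    ht_sq p (Finset.mem_of_mem_erase hp) (Finset.notMem_singleton.2 (Finset.ne_of_mem_erase hp)),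
    ht_max⟩

theorem exists_algHom_basisM28 [Nontrivial R] {u v : G} (hβ : IsCommutationForm 𝒜 β)
    (huv : β u v = 1) (hu : ∃ x ∈ 𝒜 u, x * x = i Complex.I) (hv : ∃ y ∈ 𝒜 v, y * y = -1) :
    ∃ (ψ : Matrix (Fin 2) (Fin 2) ℂ →ₐ[ℝ] R) (γ : ZMod 4 × ZMod 2 →+ G),
      (∀ h, ψ (basisM28 h) ∈ 𝒜 (γ h)) ∧ ∀ h, γ h = h.1.val • u + h.2.val • v := by
  obtain ⟨⟨x, hx, hxx⟩, y, hy, hyy⟩ := And.intro hu hv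
  refine exists_algHom_of_anticommute isTwistedFamily_basisM28 hx hy ?_ ?_
    (hβ.anticommute hx hy huv)
  · rw [pow_mul x 2 2, sq, sq, hxx, algHom_I_mul_I, Units.smul_def, Units.val_neg, Units.val_one,
      neg_one_smul]
  · rw [sq, hyy, Units.smul_def, Units.val_neg, Units.val_one, neg_one_smul]

theorem weaklyIsomorphic_typeTwo [FiniteDimensional ℝ R] (hβ : IsCommutationForm 𝒜 β)
    (hi : i.range = Subalgebra.center ℝ R) (hdiv : IsDivisionGrading 𝒜)
    (h1 : ∀ g, Module.finrank ℝ (𝒜 g) = 1) (hI : i Complex.I ∈ 𝒜 f)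
    (hG : ∃ g : G, g + g ≠ 0) : ∃ m, WeaklyIsomorphic (S := AlgTwo m) 𝒜 (typeTwo m) := by
  have := nontrivial_of_finrank h1
  have := finite_of_finrank h1
  obtain ⟨u, v, hu, hv, t, uv_mem, ht, ht_sq, ht_max⟩ :=
    hβ.exists_isSymplectic_mem hi hdiv h1 hI hG
  obtain ⟨ψ, γ, hψ, hγ⟩ := hβ.exists_algHom_basisM28 (ht.pairing _ uv_mem) hu hv
  obtain ⟨m, Ψ, α, hΨ, t_mem, form_α⟩ :=
    hβ.exists_algHom_basisPower (ht.mono (t.erase_subset (u, v))) ht_sq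
  have form_γ (g : ZMod 4 × ZMod 2) (h : Fin m → ZMod 2 × ZMod 2) : β (γ g) (α h) = 0 := by
    obtain ⟨hu, hv⟩ := ht.isOrthogonal_erase uv_mem
    simp only [hγ, map_add, map_nsmul, AddMonoidHom.add_apply, AddMonoidHom.nsmul_apply,
      form_α u hu h, form_α v hv h, smul_zero, add_zero]
  obtain ⟨Φ, hΦ⟩ := hβ.exists_algHom_tensor hψ hΨ form_γ
  have u_mem : u ∈ γ.range := ⟨(1, 0), by rw [hγ, ZMod.val_one'' (by decide)]; simp⟩
  have v_mem : v ∈ γ.range := ⟨(0, 1), by simp [hγ, ZMod.val_one]⟩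
  have surjective : Function.Surjective (γ.coprod α) := by
    rw [← AddMonoidHom.range_eq_top, range_coprod]
    refine ht.eq_top (hβ.self_eq_zero hdiv h1) (fun p hp => ?_) fun w hw =>
      AddSubgroup.mem_sup_left ?_
    · obtain rfl | hne := eq_or_ne p (u, v)
      · exact ⟨AddSubgroup.mem_sup_left u_mem, AddSubgroup.mem_sup_left v_mem⟩
      · exact (t_mem p (Finset.mem_erase.2 ⟨hne, hp⟩)).imp AddSubgroup.mem_sup_right
          AddSubgroup.mem_sup_right
    · obtain rfl | rfl := (hβ.eq_zero_iff hi hdiv h1 hI).1 (ht_max w hw)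
      · exact zero_mem _
      · exact add_self_eq_of_mul_self_eq_algHom_I hI hu ▸ add_mem u_mem u_mem
  refine ⟨m, ?_⟩
  rw [typeTwo_eq_span]
  obtain ⟨c, hc⟩ := exists_isTwistedFamily_basisTwo m
  exact weaklyIsomorphic_of_algHom (S := AlgTwo m) _ hc.zero h1 Φ surjective fun p => by
    rw [coe_basisTwo]
    exact hΦ p

end IsCommutationForm

end Classification

section Isomorphisms

theorem eq_of_matrix_algEquiv {n N : ℕ}
    (e : Matrix (Fin n) (Fin n) ℂ ≃ₐ[ℝ] Matrix (Fin N) (Fin N) ℂ) : n = N := by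
  have h := e.toLinearEquiv.finrank_eq
  simp only [Module.finrank_matrix, Fintype.card_fin, Complex.finrank_real_complex] at h
  exact Nat.mul_self_inj.1 (Nat.eq_of_mul_eq_mul_right two_pos h)

theorem nonempty_addEquiv_elementary (k : ℕ) :
    Nonempty ((Fin k → ZMod 2 × ZMod 2) × ZMod 2 ≃+ (Fin (2 * k + 1) → ZMod 2)) := by
  have : Fact (Nat.Prime 2) := ⟨Nat.prime_two⟩
  refine ⟨(LinearEquiv.ofFinrankEq (R := ZMod 2) _ _ ?_).toAddEquiv⟩
  simp [Module.finrank_pi_fintype]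
  ring

theorem nonempty_addEquiv_four (m : ℕ) :
    Nonempty ((ZMod 4 × ZMod 2) × (Fin m → ZMod 2 × ZMod 2) ≃+
      ZMod 4 × (Fin (2 * m + 1) → ZMod 2)) := by
  obtain ⟨e⟩ := nonempty_addEquiv_elementary m
  exact ⟨AddEquiv.prodAssoc.trans <|
    (AddEquiv.refl (ZMod 4)).prodCongr (AddEquiv.prodComm.trans e)⟩

end Isomorphisms

theorem range_toAlgHom_eq_center {K L D : Type*} [CommSemiring K] [CommSemiring L] [Semiring D]
    [Algebra K L] [Algebra L D] [Algebra K D] [IsScalarTower K L D] [Algebra.IsCentral L D] :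
    (IsScalarTower.toAlgHom K L D).range = Subalgebra.center K D := by
  ext x
  change (∃ a, algebraMap L D a = x) ↔ x ∈ Subalgebra.center L D
  rw [Algebra.IsCentral.mem_center_iff]
  exact exists_congr fun _ => eq_comm

theorem exists_isDivisionGrading_typeOne (k : ℕ) :
    ∃ (𝒜 : (Fin k → ZMod 2 × ZMod 2) × ZMod 2 → Submodule ℝ (Matrix (Fin (2 ^ k)) (Fin (2 ^ k)) ℂ))
      (_ : GradedAlgebra 𝒜), IsDivisionGrading 𝒜 ∧ (∀ g, Module.finrank ℝ (𝒜 g) = 1) ∧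
      WeaklyIsomorphic (S := AlgOne k) 𝒜 (typeOne k) := by
  rw [typeOne_eq_span]
  obtain ⟨c, hc⟩ := exists_isTwistedFamily_basisOne k
  exact hc.exists_isDivisionGrading (algOneEquivMatrix k)

theorem exists_isDivisionGrading_typeTwo (m : ℕ) :
    ∃ (𝒜 : (ZMod 4 × ZMod 2) × (Fin m → ZMod 2 × ZMod 2) →
        Submodule ℝ (Matrix (Fin (2 ^ (m + 1))) (Fin (2 ^ (m + 1))) ℂ))
      (_ : GradedAlgebra 𝒜), IsDivisionGrading 𝒜 ∧ (∀ g, Module.finrank ℝ (𝒜 g) = 1) ∧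
      WeaklyIsomorphic (S := AlgTwo m) 𝒜 (typeTwo m) := by
  rw [typeTwo_eq_span]
  obtain ⟨c, hc⟩ := exists_isTwistedFamily_basisTwo m
  exact hc.exists_isDivisionGrading (algTwoEquivMatrix m)

end RealDivGrading

end

open RealDivGrading in
theorem mainTheorem5_general {G R : Type*} [AddCommGroup G] [DecidableEq G] [Ring R]
    [Algebra ℝ R] [FiniteDimensional ℝ R] {𝒜 : G → Submodule ℝ R} [GradedAlgebra 𝒜]
    {i : ℂ →ₐ[ℝ] R} (hi : i.range = Subalgebra.center ℝ R) (hdiv : IsDivisionGrading 𝒜)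
    (h1 : ∀ g, Module.finrank ℝ (𝒜 g) = 1) :
    ∃ k, Nonempty (R ≃ₐ[ℝ] Matrix (Fin (2 ^ k)) (Fin (2 ^ k)) ℂ) ∧
      ((WeaklyIsomorphic (S := AlgOne k) 𝒜 (typeOne k) ∧
          Nonempty (G ≃+ (Fin (2 * k + 1) → ZMod 2))) ∨
        ∃ m, k = m + 1 ∧ WeaklyIsomorphic (S := AlgTwo m) 𝒜 (typeTwo m) ∧
          Nonempty (G ≃+ ZMod 4 × (Fin (2 * m + 1) → ZMod 2))) := by
  have := nontrivial_of_finrank h1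
  obtain ⟨β, hβ⟩ := exists_isCommutationForm hdiv h1
  obtain ⟨f, hI⟩ := exists_algHom_I_mem hi h1
  by_cases hG : ∀ g : G, g + g = 0
  · obtain ⟨k, φ, α, h⟩ := hβ.weaklyIsomorphic_typeOne hi hdiv h1 hI hG
    exact ⟨k, ⟨φ.trans (algOneEquivMatrix k)⟩,
      .inl ⟨⟨φ, α, h⟩, (nonempty_addEquiv_elementary k).map α.trans⟩⟩
  · obtain ⟨m, φ, α, h⟩ := hβ.weaklyIsomorphic_typeTwo hi hdiv h1 hI (not_forall.1 hG)
    exact ⟨m + 1, ⟨φ.trans (algTwoEquivMatrix m)⟩,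
      .inr ⟨m, rfl, ⟨φ, α, h⟩, (nonempty_addEquiv_four m).map α.trans⟩⟩

theorem mainTheorem5 :
    -- classification of the division gradings with one-dimensional components
    (∀ (n : ℕ) (G : Type*) [AddCommGroup G] [DecidableEq G]
        (𝒜 : G → Submodule ℝ (Matrix (Fin n) (Fin n) ℂ)) [GradedAlgebra 𝒜],
        RealDivGrading.IsDivisionGrading 𝒜 →
        (∀ g : G, Module.finrank ℝ (𝒜 g) = 1) →
        ∃ k : ℕ, n = 2 ^ k ∧
          ((RealDivGrading.WeaklyIsomorphic (S := RealDivGrading.AlgOne k) 𝒜 (RealDivGrading.typeOne k) ∧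
              Nonempty (G ≃+ (Fin (2 * k + 1) → ZMod 2))) ∨
            ∃ m : ℕ, k = m + 1 ∧
              RealDivGrading.WeaklyIsomorphic (S := RealDivGrading.AlgTwo m) 𝒜 (RealDivGrading.typeTwo m) ∧
              Nonempty (G ≃+ ZMod 4 × (Fin (2 * m + 1) → ZMod 2)))) ∧
    -- the first form occurs on `M_n(ℂ)`, `n = 2 ^ k`, for every `k`
    (∀ k : ℕ, ∃ (𝒜 : (Fin k → ZMod 2 × ZMod 2) × ZMod 2 →
          Submodule ℝ (Matrix (Fin (2 ^ k)) (Fin (2 ^ k)) ℂ)) (_ : GradedAlgebra 𝒜),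
        RealDivGrading.IsDivisionGrading 𝒜 ∧ (∀ g, Module.finrank ℝ (𝒜 g) = 1) ∧
          RealDivGrading.WeaklyIsomorphic (S := RealDivGrading.AlgOne k) 𝒜 (RealDivGrading.typeOne k)) ∧
    -- the second form occurs on `M_n(ℂ)`, `n = 2 ^ k`, for every `k = m + 1`
    (∀ m : ℕ, ∃ (𝒜 : (ZMod 4 × ZMod 2) × (Fin m → ZMod 2 × ZMod 2) →
          Submodule ℝ (Matrix (Fin (2 ^ (m + 1))) (Fin (2 ^ (m + 1))) ℂ)) (_ : GradedAlgebra 𝒜),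
        RealDivGrading.IsDivisionGrading 𝒜 ∧ (∀ g, Module.finrank ℝ (𝒜 g) = 1) ∧
          RealDivGrading.WeaklyIsomorphic (S := RealDivGrading.AlgTwo m) 𝒜 (RealDivGrading.typeTwo m)) := by
  refine ⟨fun n G _ _ 𝒜 _ hdiv h1 => ?_, RealDivGrading.exists_isDivisionGrading_typeOne,
    RealDivGrading.exists_isDivisionGrading_typeTwo⟩
  obtain ⟨k, ⟨e⟩, h⟩ := mainTheorem5_general RealDivGrading.range_toAlgHom_eq_center hdiv h1
  exact ⟨k, RealDivGrading.eq_of_matrix_algEquiv e, h⟩
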